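/- **Corollary 5.** A regular germ $f_a$ at a point $a$ of the Riemann sphere $\mathbb S^2=\mathbb C\cup\{\infty\}$ is the germ at $a$ of a holomorphic function with values in $\mathbb C$. Two regular germs are equivalent if one is obtained from the other by analytic continuation along a path in $\mathbb S^2$; the multivalued analytic function $f$ generated by $f_a$ is the collection of all regular germs equivalent to $f_a$, which are called its germs. A point $b\in\mathbb S^2$ is a singular point of $f$ if for some germ $f_a$ of $f$ there is a path $\gamma:[0,1]\to\mathbb S^2$ from $a$ to $b$ such that $f_a$ has no analytic continuation along $\gamma$, but has one along $\gamma|_{[0,\tau]}$ for every $0\le\tau<1$. An operation on multivalued functions is performed on arbitrary regular germs of the given functions at a common point, and its results are all multivalued functions generated by the regular germs so obtained. (For a composition $f\circ g$ one takes a germ of $g$ at $a$ and a germ of $f$ at $g(a)$; for a quotient $f/g$ the germ of $g$ is not identically zero.) The class given by a list of basic functions and a list of operations consists of all functions obtained from the basic ones by repeated application of the operations. The basic elementary functions are: the complex constants, the independent variable $x$, $\exp$, $\log$, $x^\alpha$ $(\alpha\in\mathbb C)$, $\sin,\cos,\tan,\cot,\arcsin,\arccos,\arctan,\operatorname{arccot}$.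 With these as basic functions, one defines * functions representable by quadratures, by the operations of composition, the arithmetic operations $f+g$, $f-g$, $fg$, $f/g$, differentiation, and integration (passing from $f$ to a solution of $y'=f$); * functions representable by $k$-quadratures, by the same operations and the solution of algebraic equations $y^n+f_1y^{n-1}+\dots+f_n=0$ of degree $n\le k$; * functions representable by generalized quadratures, by the same operations as for quadratures and the solution of algebraic equations of any degree; * generalized elementary functions, by composition, arithmetic operations, differentiation, and the solution of algebraic equations of any degree. Let $f$ be a multivalued analytic function whose set of singular points is uncountable. Then $f$ is not representable by generalized quadratures. In particular, $f$ is not a generalized elementary function, and $f$ is representable neither by $k$-quadratures, for any $k\in\mathbb N$, nor by quadratures. -/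

import Mathlib

namespace FiniteTerms

open scoped Topology unitInterval

/-- The Riemann sphere. -/
abbrev Sphere : Type := OnePoint ℂ

/-- The chart of the sphere at infinity, `w ↦ 1 / w`, with `0 ↦ ∞`. -/
noncomputable def chartInfty (w : ℂ) : Sphere :=
  open Classical in if w = 0 then OnePoint.infty else ((w⁻¹ : ℂ) : Sphere)

/-- `φ` is holomorphic (with finite values) in a neighbourhood of the point `a` of the sphere. A
regular germ at `a` is given by any `φ` with `RegularAt φ a`; two such functions give the same germ
when they agree near `a`. -/
def RegularAt (φ : Sphere → ℂ) (a : Sphere) : Prop :=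
  (∀ z : ℂ, a = (z : Sphere) → AnalyticAt ℂ (fun w : ℂ => φ (w : Sphere)) z) ∧
  (a = OnePoint.infty → AnalyticAt ℂ (fun w : ℂ => φ (chartInfty w)) 0)

/-- `F` is an analytic continuation of the germ of `φ` at `a` along the part `[0, τ]` of the path
`γ`: `F t` is a regular germ at `γ t`, the germs at nearby times being induced by the same
function. -/
def IsContinuation {a b : Sphere} (γ : Path a b) (τ : I) (φ : Sphere → ℂ)
    (F : I → Sphere → ℂ) : Prop :=
  F 0 =ᶠ[𝓝 a] φ ∧
  ∀ t : I, t ≤ τ → RegularAt (F t) (γ t) ∧ ∀ᶠ s in 𝓝 t, s ≤ τ → F s =ᶠ[𝓝 (γ s)] F t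

/-- The germ of `ψ` at `b` is obtained from the germ of `φ` at `a` by analytic continuation along
some path. -/
def Equivalent (a : Sphere) (φ : Sphere → ℂ) (b : Sphere) (ψ : Sphere → ℂ) : Prop :=
  ∃ (γ : Path a b) (F : I → Sphere → ℂ), IsContinuation γ 1 φ F ∧ F 1 =ᶠ[𝓝 b] ψ

/-- `b` is a singular point for the germ of `φ` at `a`. -/
def IsSingularPoint (a : Sphere) (φ : Sphere → ℂ) (b : Sphere) : Prop :=
  ∃ γ : Path a b, (¬ ∃ F, IsContinuation γ 1 φ F) ∧ ∀ τ : I, τ < 1 → ∃ F, IsContinuation γ τ φ F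

/-- A multivalued analytic function on the sphere: the collection of all regular germs equivalent
to one given regular germ. `IsGerm a φ` says that `φ` represents one of its germs at `a`. -/
structure MultivaluedFunction where
  IsGerm : Sphere → (Sphere → ℂ) → Prop
  generated : ∃ a φ, RegularAt φ a ∧ ∀ b ψ, IsGerm b ψ ↔ Equivalent a φ b ψ

/-- `f` is the multivalued function generated by the regular germ of `φ` at `a`. -/
def MultivaluedFunction.IsGeneratedBy (f : MultivaluedFunction) (a : Sphere)
    (φ : Sphere → ℂ) : Prop :=
  RegularAt φ a ∧ ∀ b ψ, f.IsGerm b ψ ↔ Equivalent a φ b ψ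

/-- The set of singular points of a multivalued function. -/
def MultivaluedFunction.singularPoints (f : MultivaluedFunction) : Set Sphere :=
  {b | ∃ a φ, f.IsGerm a φ ∧ IsSingularPoint a φ b}

/-- `f` is generated by a germ of the (single valued) function `u`. -/
def IsFunction (u : ℂ → ℂ) (f : MultivaluedFunction) : Prop :=
  ∃ a φ, f.IsGeneratedBy a φ ∧ ∀ᶠ x in 𝓝 a, ∀ z : ℂ, x = (z : Sphere) → φ x = u z

/-- `f` is generated by a germ `φ` inverse to `u`, that is `u (φ z) = z`. -/
def IsInverseFunction (u : ℂ → ℂ) (f : MultivaluedFunction) : Prop :=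
  ∃ a φ, f.IsGeneratedBy a φ ∧ ∀ᶠ x in 𝓝 a, ∀ z : ℂ, x = (z : Sphere) → u (φ x) = z

/-- `f` is the power `x ^ α`: it is generated by a germ `exp (α ℓ)`, where `ℓ` is a germ of the
logarithm. -/
def IsPower (α : ℂ) (f : MultivaluedFunction) : Prop :=
  ∃ a l, RegularAt l a ∧
    (∀ᶠ x in 𝓝 a, ∀ z : ℂ, x = (z : Sphere) → Complex.exp (l x) = z) ∧
    f.IsGeneratedBy a (fun x => Complex.exp (α * l x))

/-- The basic elementary functions. -/
inductive BasicElementary : MultivaluedFunction → Prop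
  | const (c : ℂ) {f} : IsFunction (fun _ => c) f → BasicElementary f
  | var {f} : IsFunction (fun z => z) f → BasicElementary f
  | exp {f} : IsFunction Complex.exp f → BasicElementary f
  | log {f} : IsInverseFunction Complex.exp f → BasicElementary f
  | power (α : ℂ) {f} : IsPower α f → BasicElementary f
  | sin {f} : IsFunction Complex.sin f → BasicElementary f
  | cos {f} : IsFunction Complex.cos f → BasicElementary f
  | tan {f} : IsFunction Complex.tan f → BasicElementary f
  | cot {f} : IsFunction Complex.cot f → BasicElementary f
  | arcsin {f} : IsInverseFunction Complex.sin f → BasicElementary f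
  | arccos {f} : IsInverseFunction Complex.cos f → BasicElementary f
  | arctan {f} : IsInverseFunction Complex.tan f → BasicElementary f
  | arccot {f} : IsInverseFunction Complex.cot f → BasicElementary f

/-- An operation on multivalued functions: `Op fs h` says that `h` is one of the functions obtained
from the list of functions `fs` by the operation. -/
abbrev Operation : Type := List MultivaluedFunction → MultivaluedFunction → Prop

/-- `h` is representable as `f ∘ g`. -/
inductive Composition : Operation
  | comp {f g h : MultivaluedFunction} {a : Sphere} {φ ψ : Sphere → ℂ} :
      g.IsGerm a ψ → f.IsGerm ((ψ a : ℂ) : Sphere) φ →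
      h.IsGeneratedBy a (fun x => φ ((ψ x : ℂ) : Sphere)) → Composition [f, g] h

/-- `h` is representable as `f + g`, `f - g`, `f g` or `f / g`. In the last case the germ of `g` is
not identically zero. -/
inductive Arithmetic : Operation
  | add {f g h : MultivaluedFunction} {a : Sphere} {φ ψ : Sphere → ℂ} :
      f.IsGerm a φ → g.IsGerm a ψ → h.IsGeneratedBy a (fun x => φ x + ψ x) → Arithmetic [f, g] h
  | sub {f g h : MultivaluedFunction} {a : Sphere} {φ ψ : Sphere → ℂ} :
      f.IsGerm a φ → g.IsGerm a ψ → h.IsGeneratedBy a (fun x => φ x - ψ x) → Arithmetic [f, g] h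
  | mul {f g h : MultivaluedFunction} {a : Sphere} {φ ψ : Sphere → ℂ} :
      f.IsGerm a φ → g.IsGerm a ψ → h.IsGeneratedBy a (fun x => φ x * ψ x) → Arithmetic [f, g] h
  | div {f g h : MultivaluedFunction} {a : Sphere} {φ ψ χ : Sphere → ℂ} :
      f.IsGerm a φ → g.IsGerm a ψ → (¬ ∀ᶠ x in 𝓝 a, ψ x = 0) → h.IsGeneratedBy a χ →
      (∀ᶠ x in 𝓝 a, χ x * ψ x = φ x) → Arithmetic [f, g] h

/-- Near `a` (at finite points), `χ` is the derivative of `φ` with respect to the independent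
variable. -/
def IsDerivativeNear (a : Sphere) (φ χ : Sphere → ℂ) : Prop :=
  ∀ᶠ x in 𝓝 a, ∀ z : ℂ, x = (z : Sphere) → HasDerivAt (fun w : ℂ => φ (w : Sphere)) (χ x) z

/-- `h` is representable as `f'`. -/
inductive Differentiation : Operation
  | deriv {f h : MultivaluedFunction} {a : Sphere} {φ χ : Sphere → ℂ} :
      f.IsGerm a φ → h.IsGeneratedBy a χ → IsDerivativeNear a φ χ → Differentiation [f] h

/-- `h` is representable as a solution `y` of `y' = f`. -/
inductive Integration : Operation
  | integral {f h : MultivaluedFunction} {a : Sphere} {φ χ : Sphere → ℂ} :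
      f.IsGerm a φ → h.IsGeneratedBy a χ → IsDerivativeNear a χ φ → Integration [f] h

/-- `h` is representable as a solution `y` of an algebraic equation
`y ^ n + f₁ y ^ (n - 1) + ⋯ + fₙ = 0` whose degree `n` satisfies `D n`; the
coefficients `f₁, …, fₙ` are `f i` for `i = 0, …, n - 1`. -/
inductive Algebraic (D : ℕ → Prop) : Operation
  | solution {n : ℕ} {f : Fin n → MultivaluedFunction} {h : MultivaluedFunction} {a : Sphere}
      {φ : Fin n → Sphere → ℂ} {χ : Sphere → ℂ} :
      D n → (∀ i, (f i).IsGerm a (φ i)) → h.IsGeneratedBy a χ →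
      (∀ᶠ x in 𝓝 a, χ x ^ n + ∑ i : Fin n, φ i x * χ x ^ (n - 1 - (i : ℕ)) = 0) →
      Algebraic D (List.ofFn f) h

/-- The class of functions given by a list of basic functions and a list of admissible operations:
all functions obtained from the basic ones by repeated application of the operations. -/
inductive FunctionClass (Basic : MultivaluedFunction → Prop) (Op : Operation) :
    MultivaluedFunction → Prop
  | basic {f} : Basic f → FunctionClass Basic Op f
  | op {fs h} : (∀ f ∈ fs, FunctionClass Basic Op f) → Op fs h → FunctionClass Basic Op h

/-- Generalized elementary functions. -/
def GeneralizedElementary : MultivaluedFunction → Prop :=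
  FunctionClass BasicElementary
    (Composition ⊔ Arithmetic ⊔ Differentiation ⊔ Algebraic (fun _ => True))

/-- Functions representable by quadratures. -/
def RepresentableByQuadratures : MultivaluedFunction → Prop :=
  FunctionClass BasicElementary (Composition ⊔ Arithmetic ⊔ Differentiation ⊔ Integration)

/-- Functions representable by `k`-quadratures. -/
def RepresentableByKQuadratures (k : ℕ) : MultivaluedFunction → Prop :=
  FunctionClass BasicElementary
    (Composition ⊔ Arithmetic ⊔ Differentiation ⊔ Integration ⊔ Algebraic (fun n => n ≤ k))

/-- Functions representable by generalized quadratures. -/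
def RepresentableByGeneralizedQuadratures : MultivaluedFunction → Prop :=
  FunctionClass BasicElementary
    (Composition ⊔ Arithmetic ⊔ Differentiation ⊔ Integration ⊔ Algebraic (fun _ => True))

end FiniteTerms

namespace FiniteTerms

open scoped Topology unitInterval
open Filter Set Topology

/-! Attach to a germ a countable set `A` such that the germ continues along every path that avoids
`A` after its initial time (`IsForbidden`). Such a set contains all singular points, and the
functions possessing one include the basic elementary functions and are closed under every operation
in question; so a function with uncountably many singular points lies outside all four classes. The
initial point is exempt because one branch may be regular at a point of `A` where another is
singular.

Two facts make countability the right notion of smallness. First, a path can be pushed off a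
countable set by a small move that takes its family of germs along (`exists_perturbation`), because
in the plane the displacements that hit a given point form a set of dimension at most one. Hence a
countable forbidden set of one germ serves all its continuations (`IsForbidden.of_reaches`) and
catches every singular point (`IsForbidden.mem_of_isSingularPoint`). Second, countably many
functions represent all continuations of a germ (Poincaré–Volterra,
`exists_countable_representatives`), so a nonconstant multivalued function takes a given value at
only countably many points (`countable_setOf_reaches_eq`).

The second fact bounds what the operations add: zeros of a denominator, preimages of the forbidden
set of an outer function, and, for an algebraic equation, zeros of a leading coefficient and of a
discriminant-like element, off which the roots are simple and locally holomorphic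
(`exists_isForbidden_of_isIntegral`). Differentiation and integration add only `∞`. Among the basic
functions, the logarithm, arctangent and arccotangent are integrals of rational functions, the
arcsine and arccosine of algebraic ones. -/

/-! ### Charts of the sphere -/

/-- A holomorphic chart of the sphere, parametrized by the whole plane. -/
structure IsChart (c : ℂ → Sphere) : Prop where
  isOpenEmbedding : IsOpenEmbedding c
  regularAt_iff : ∀ (φ : Sphere → ℂ) (z : ℂ), RegularAt φ (c z) ↔ AnalyticAt ℂ (fun w => φ (c w)) z

theorem regularAt_coe {φ : Sphere → ℂ} {z : ℂ} :
    RegularAt φ (z : Sphere) ↔ AnalyticAt ℂ (fun w : ℂ => φ (w : Sphere)) z := by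
  constructor
  · exact fun h => h.1 z rfl
  · refine fun h => ⟨fun z' hz => ?_, fun h' => absurd h' (OnePoint.coe_ne_infty z)⟩
    rwa [← OnePoint.coe_injective hz]

theorem regularAt_infty {φ : Sphere → ℂ} :
    RegularAt φ OnePoint.infty ↔ AnalyticAt ℂ (fun w : ℂ => φ (chartInfty w)) 0 :=
  ⟨fun h => h.2 rfl, fun h => ⟨fun z hz => absurd hz.symm (OnePoint.coe_ne_infty z), fun _ => h⟩⟩

theorem isChart_coe : IsChart (fun z : ℂ => (z : Sphere)) :=
  ⟨OnePoint.isOpenEmbedding_coe, fun _ _ => regularAt_coe⟩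

theorem chartInfty_zero : chartInfty 0 = OnePoint.infty := by simp [chartInfty]

theorem chartInfty_of_ne_zero {w : ℂ} (hw : w ≠ 0) : chartInfty w = ((w⁻¹ : ℂ) : Sphere) := by
  simp [chartInfty, hw]

/-- The inversion `x ↦ 1 / x` of the sphere. -/
noncomputable def sphereInv (x : Sphere) : Sphere :=
  OnePoint.elim x ((0 : ℂ) : Sphere) chartInfty

theorem sphereInv_coe (z : ℂ) : sphereInv (z : Sphere) = chartInfty z := rfl

theorem sphereInv_infty : sphereInv OnePoint.infty = ((0 : ℂ) : Sphere) := rfl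

theorem sphereInv_sphereInv (x : Sphere) : sphereInv (sphereInv x) = x := by
  induction x using OnePoint.rec with
  | infty => rw [sphereInv_infty, sphereInv_coe, chartInfty_zero]
  | coe z =>
    rw [sphereInv_coe]
    by_cases hz : z = 0
    · rw [hz, chartInfty_zero, sphereInv_infty]
    · rw [chartInfty_of_ne_zero hz, sphereInv_coe, chartInfty_of_ne_zero (inv_ne_zero hz), inv_inv]

theorem continuous_chartInfty : Continuous chartInfty := by
  rw [continuous_iff_continuousAt]
  intro z
  by_cases hz : z = 0
  · subst hz
    rw [continuousAt_iff_punctured_nhds, chartInfty_zero]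
    have h : Tendsto (fun w : ℂ => ((w⁻¹ : ℂ) : Sphere)) (𝓝[≠] 0) (𝓝 OnePoint.infty) := by
      refine OnePoint.tendsto_coe_infty.comp ?_
      rw [Filter.coclosedCompact_eq_cocompact, ← Metric.cobounded_eq_cocompact]
      exact tendsto_inv₀_nhdsNE_zero
    refine h.congr' ?_
    filter_upwards [self_mem_nhdsWithin] with w hw
    exact (chartInfty_of_ne_zero hw).symm
  · have h : ContinuousAt (fun w : ℂ => ((w⁻¹ : ℂ) : Sphere)) z :=
      OnePoint.continuous_coe.continuousAt.comp (continuousAt_inv₀ hz)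
    refine h.congr ?_
    filter_upwards [isOpen_ne.mem_nhds hz] with w hw
    exact (chartInfty_of_ne_zero hw).symm

theorem continuous_sphereInv : Continuous sphereInv := by
  rw [OnePoint.continuous_iff]
  refine ⟨?_, continuous_chartInfty⟩
  rw [Filter.coclosedCompact_eq_cocompact, ← Metric.cobounded_eq_cocompact, sphereInv_infty]
  have h : Tendsto (fun w : ℂ => ((w⁻¹ : ℂ) : Sphere)) (Bornology.cobounded ℂ)
      (𝓝 ((0 : ℂ) : Sphere)) :=
    OnePoint.continuous_coe.continuousAt.tendsto.comp tendsto_inv₀_cobounded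
  refine h.congr' ?_
  filter_upwards [Bornology.eventually_ne_cobounded (0 : ℂ)] with w hw
  rw [sphereInv_coe, chartInfty_of_ne_zero hw]

/-- `chartInfty` is the inclusion of the plane followed by the inversion, an involutive
self-homeomorphism of the sphere. -/
theorem isOpenEmbedding_chartInfty : IsOpenEmbedding chartInfty := by
  let e : Sphere ≃ₜ Sphere :=
    { toFun := sphereInv, invFun := sphereInv, left_inv := sphereInv_sphereInv,
      right_inv := sphereInv_sphereInv, continuous_toFun := continuous_sphereInv,
      continuous_invFun := continuous_sphereInv }
  exact e.isOpenEmbedding.comp OnePoint.isOpenEmbedding_coe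

theorem isChart_chartInfty : IsChart chartInfty := by
  refine ⟨isOpenEmbedding_chartInfty, fun φ z => ?_⟩
  by_cases hz : z = 0
  · subst hz
    rw [chartInfty_zero, regularAt_infty]
  · rw [chartInfty_of_ne_zero hz, regularAt_coe]
    have key : ∀ {g : ℂ → ℂ} {x : ℂ}, x ≠ 0 → AnalyticAt ℂ g x⁻¹ →
        AnalyticAt ℂ (fun w => g w⁻¹) x := fun hx hg =>
      AnalyticAt.comp_of_eq hg (analyticAt_inv hx) rfl
    constructor
    · intro h
      refine (key hz h).congr ?_
      filter_upwards [isOpen_ne.mem_nhds hz] with w hw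
      rw [chartInfty_of_ne_zero hw]
    · intro h
      have h2 := key (inv_ne_zero hz) (by rwa [inv_inv])
      refine h2.congr ?_
      filter_upwards [isOpen_ne.mem_nhds (inv_ne_zero hz)] with w hw
      rw [chartInfty_of_ne_zero (inv_ne_zero hw), inv_inv]

theorem exists_isChart (a : Sphere) : ∃ c, IsChart c ∧ ∃ z, c z = a := by
  induction a using OnePoint.rec with
  | infty => exact ⟨_, isChart_chartInfty, 0, chartInfty_zero⟩
  | coe z => exact ⟨_, isChart_coe, z, rfl⟩

theorem mem_range_coe_or_mem_range_chartInfty (a : Sphere) :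
    a ∈ range (fun z : ℂ => (z : Sphere)) ∨ a ∈ range chartInfty := by
  induction a using OnePoint.rec with
  | infty => exact Or.inr ⟨0, chartInfty_zero⟩
  | coe z => exact Or.inl ⟨z, rfl⟩

theorem IsChart.map_nhds {c : ℂ → Sphere} (hc : IsChart c) (z : ℂ) : map c (𝓝 z) = 𝓝 (c z) :=
  hc.isOpenEmbedding.map_nhds_eq z

theorem IsChart.eventually_iff {c : ℂ → Sphere} (hc : IsChart c) {z : ℂ} {p : Sphere → Prop} :
    (∀ᶠ x in 𝓝 (c z), p x) ↔ ∀ᶠ w in 𝓝 z, p (c w) := by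
  rw [← hc.map_nhds, eventually_map]

theorem IsChart.frequently_punctured_iff {c : ℂ → Sphere} (hc : IsChart c) {z : ℂ}
    {p : Sphere → Prop} : (∃ᶠ x in 𝓝[≠] (c z), p x) ↔ ∃ᶠ w in 𝓝[≠] z, p (c w) := by
  have h : map c (𝓝[≠] z) = 𝓝[≠] (c z) := by
    rw [hc.isOpenEmbedding.isEmbedding.map_nhdsWithin_eq]
    have : c '' {z}ᶜ = range c \ {c z} := by
      ext x
      constructor
      · rintro ⟨w, hw, rfl⟩
        exact ⟨⟨w, rfl⟩, fun h => hw (hc.isOpenEmbedding.injective h)⟩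
      · rintro ⟨⟨w, rfl⟩, hw⟩
        exact ⟨w, fun h => hw (congrArg c h), rfl⟩
    rw [this, sdiff_eq, nhdsWithin_inter_of_mem]
    exact mem_nhdsWithin_of_mem_nhds (hc.isOpenEmbedding.isOpen_range.mem_nhds ⟨z, rfl⟩)
  rw [← h, frequently_map]

/-- Two open copies of the plane cover the sphere. Second countability yields the metric below and
feeds `countable_of_isolated`. -/
instance : SecondCountableTopology Sphere := by
  have h : ∀ c : ℂ → Sphere, IsChart c → SecondCountableTopology (range c) := fun c hc =>
    (hc.isOpenEmbedding.isEmbedding.toHomeomorph).symm.secondCountableTopology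
  let U : Bool → Set Sphere := fun b =>
    bif b then range (fun z : ℂ => (z : Sphere)) else range chartInfty
  have hU : ∀ b, SecondCountableTopology (U b) := by
    rintro (_ | _)
    · exact h _ isChart_chartInfty
    · exact h _ isChart_coe
  refine TopologicalSpace.secondCountableTopology_of_countable_cover (U := U) ?_ ?_
  · rintro (_ | _)
    · exact isChart_chartInfty.isOpenEmbedding.isOpen_range
    · exact isChart_coe.isOpenEmbedding.isOpen_range
  · refine eq_univ_of_forall fun x => mem_iUnion.2 ?_
    rcases mem_range_coe_or_mem_range_chartInfty x with hx | hx
    · exact ⟨true, hx⟩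
    · exact ⟨false, hx⟩

/-- Any compatible metric will do: it measures how far a path is moved in
`exists_perturbation_in_chart`, also where the path leaves the chart. -/
noncomputable instance : MetricSpace Sphere := TopologicalSpace.metrizableSpaceMetric Sphere

/-! ### Regular germs -/

theorem RegularAt.congr {φ ψ : Sphere → ℂ} {a : Sphere} (h : RegularAt φ a) (e : φ =ᶠ[𝓝 a] ψ) :
    RegularAt ψ a := by
  obtain ⟨c, hc, z, rfl⟩ := exists_isChart a
  rw [hc.regularAt_iff] at h ⊢
  exact h.congr (hc.eventually_iff.1 e)

theorem RegularAt.eventually {φ : Sphere → ℂ} {a : Sphere} (h : RegularAt φ a) :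
    ∀ᶠ x in 𝓝 a, RegularAt φ x := by
  obtain ⟨c, hc, z, rfl⟩ := exists_isChart a
  rw [hc.regularAt_iff] at h
  rw [hc.eventually_iff]
  filter_upwards [h.eventually_analyticAt] with w hw
  exact (hc.regularAt_iff _ _).2 hw

theorem RegularAt.continuousAt {φ : Sphere → ℂ} {a : Sphere} (h : RegularAt φ a) :
    ContinuousAt φ a := by
  obtain ⟨c, hc, z, rfl⟩ := exists_isChart a
  rw [hc.regularAt_iff] at h
  exact (hc.isOpenEmbedding.continuousAt_iff).1 h.continuousAt

/-- Apply a statement about analytic functions in a chart. -/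
theorem RegularAt.of_analytic₂ {φ ψ χ : Sphere → ℂ} {a : Sphere} (hφ : RegularAt φ a)
    (hψ : RegularAt ψ a)
    (H : ∀ (c : ℂ → Sphere) (z : ℂ), AnalyticAt ℂ (fun w => φ (c w)) z →
      AnalyticAt ℂ (fun w => ψ (c w)) z → AnalyticAt ℂ (fun w => χ (c w)) z) : RegularAt χ a := by
  obtain ⟨c, hc, z, rfl⟩ := exists_isChart a
  rw [hc.regularAt_iff] at hφ hψ ⊢
  exact H c z hφ hψ

theorem regularAt_const (k : ℂ) (a : Sphere) : RegularAt (fun _ => k) a := by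
  obtain ⟨c, hc, z, rfl⟩ := exists_isChart a
  rw [hc.regularAt_iff]
  exact analyticAt_const

theorem RegularAt.add {φ ψ : Sphere → ℂ} {a : Sphere} (hφ : RegularAt φ a) (hψ : RegularAt ψ a) :
    RegularAt (fun x => φ x + ψ x) a :=
  hφ.of_analytic₂ hψ fun _ _ h₁ h₂ => h₁.add h₂

theorem RegularAt.sub {φ ψ : Sphere → ℂ} {a : Sphere} (hφ : RegularAt φ a) (hψ : RegularAt ψ a) :
    RegularAt (fun x => φ x - ψ x) a :=
  hφ.of_analytic₂ hψ fun _ _ h₁ h₂ => h₁.sub h₂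

theorem RegularAt.mul {φ ψ : Sphere → ℂ} {a : Sphere} (hφ : RegularAt φ a) (hψ : RegularAt ψ a) :
    RegularAt (fun x => φ x * ψ x) a :=
  hφ.of_analytic₂ hψ fun _ _ h₁ h₂ => h₁.mul h₂

theorem RegularAt.div {φ ψ : Sphere → ℂ} {a : Sphere} (hφ : RegularAt φ a) (hψ : RegularAt ψ a)
    (h0 : ψ a ≠ 0) : RegularAt (fun x => φ x / ψ x) a := by
  obtain ⟨c, hc, z, rfl⟩ := exists_isChart a
  rw [hc.regularAt_iff] at hφ hψ ⊢
  exact AnalyticAt.fun_div hφ hψ h0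

/-- Composition with a germ of a function on the sphere. -/
theorem RegularAt.comp {φ ψ : Sphere → ℂ} {a : Sphere} (hφ : RegularAt φ ((ψ a : ℂ) : Sphere))
    (hψ : RegularAt ψ a) : RegularAt (fun x => φ ((ψ x : ℂ) : Sphere)) a := by
  obtain ⟨c, hc, z, rfl⟩ := exists_isChart a
  rw [hc.regularAt_iff] at hψ ⊢
  rw [regularAt_coe] at hφ
  exact AnalyticAt.comp_of_eq (g := fun w : ℂ => φ (w : Sphere)) hφ hψ rfl

theorem RegularAt.comp_analyticAt {u : ℂ → ℂ} {ψ : Sphere → ℂ} {a : Sphere}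
    (hu : AnalyticAt ℂ u (ψ a)) (hψ : RegularAt ψ a) : RegularAt (fun x => u (ψ x)) a := by
  obtain ⟨c, hc, z, rfl⟩ := exists_isChart a
  rw [hc.regularAt_iff] at hψ ⊢
  exact AnalyticAt.comp_of_eq hu hψ rfl

theorem RegularAt.eventuallyEq_of_frequently {φ ψ : Sphere → ℂ} {a : Sphere} (hφ : RegularAt φ a)
    (hψ : RegularAt ψ a) (h : ∃ᶠ x in 𝓝[≠] a, φ x = ψ x) : φ =ᶠ[𝓝 a] ψ := by
  obtain ⟨c, hc, z, rfl⟩ := exists_isChart a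
  rw [hc.regularAt_iff] at hφ hψ
  exact hc.eventually_iff.2 ((hφ.frequently_eq_iff_eventually_eq hψ).1
    (hc.frequently_punctured_iff.1 h))

/-- The identity theorem on a preconnected set. -/
theorem eventuallyEq_of_isPreconnected {φ ψ : Sphere → ℂ} {C : Set Sphere} (hC : IsPreconnected C)
    (hφ : ∀ x ∈ C, RegularAt φ x) (hψ : ∀ x ∈ C, RegularAt ψ x) {a b : Sphere} (ha : a ∈ C)
    (hb : b ∈ C) (h : φ =ᶠ[𝓝 a] ψ) : φ =ᶠ[𝓝 b] ψ := by
  have hopen : IsOpen {x | φ =ᶠ[𝓝 x] ψ} := isOpen_iff_mem_nhds.2 fun x hx =>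
    eventually_eventually_nhds.2 hx
  refine hC.subset_of_closure_inter_subset hopen ⟨a, ha, h⟩ ?_ hb
  rintro x ⟨hx, hxC⟩
  refine (hφ x hxC).eventuallyEq_of_frequently (hψ x hxC) ?_
  rw [frequently_iff]
  intro U hU
  obtain ⟨V, hV, hVo, hVx⟩ := eventually_nhds_iff.1 (eventually_nhdsWithin_iff.1 hU)
  obtain ⟨y, hyV, hy⟩ := mem_closure_iff.1 hx V hVo hVx
  have h2 : ∀ᶠ w in 𝓝[≠] y, φ w = ψ w := mem_nhdsWithin_of_mem_nhds hy
  -- The point of the closure may be `x` itself, which says nothing about punctured neighbourhoods;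
  -- the germs then agree near `x` and another nearby point is taken.
  by_cases hxy : y = x
  · subst hxy
    have h3 : ∀ᶠ w in 𝓝[≠] y, w ∈ V := mem_nhdsWithin_of_mem_nhds (hVo.mem_nhds hVx)
    obtain ⟨w, h4, h5, h6⟩ := (h2.and (h3.and self_mem_nhdsWithin)).exists
    exact ⟨w, hV w h5 h6, h4⟩
  · exact ⟨y, hV y hyV hxy, EventuallyEq.eq_of_nhds hy⟩

/-- Small preconnected neighbourhoods. -/
theorem exists_isPreconnected_nhds {a : Sphere} {U : Set Sphere} (hU : U ∈ 𝓝 a) :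
    ∃ V, IsOpen V ∧ IsPreconnected V ∧ a ∈ V ∧ V ⊆ U := by
  obtain ⟨c, hc, z, rfl⟩ := exists_isChart a
  obtain ⟨r, hr, hrU⟩ := Metric.eventually_nhds_iff_ball.1 (hc.eventually_iff.1 hU)
  refine ⟨c '' Metric.ball z r, hc.isOpenEmbedding.isOpenMap _ Metric.isOpen_ball,
    (convex_ball z r).isPreconnected.image _ hc.isOpenEmbedding.continuous.continuousOn,
    ⟨z, Metric.mem_ball_self hr, rfl⟩, ?_⟩
  rintro _ ⟨w, hw, rfl⟩
  exact hrU w hw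

/-! ### Continuation along real-time paths -/

/-- `F` is a family of regular germs along `γ`, locally constant at the times in `T`. -/
def IsContinuationOn (γ : ℝ → Sphere) (F : ℝ → Sphere → ℂ) (T : Set ℝ) : Prop :=
  ∀ t ∈ T, RegularAt (F t) (γ t) ∧ ∀ᶠ s in 𝓝[T] t, F s =ᶠ[𝓝 (γ s)] F t

theorem IsContinuationOn.mono {γ : ℝ → Sphere} {F : ℝ → Sphere → ℂ} {T T' : Set ℝ}
    (h : IsContinuationOn γ F T) (hT : T' ⊆ T) : IsContinuationOn γ F T' := fun t ht =>
  ⟨(h t (hT ht)).1, nhdsWithin_mono _ hT (h t (hT ht)).2⟩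

theorem IsContinuationOn.congr_path {γ γ' : ℝ → Sphere} {F : ℝ → Sphere → ℂ} {T : Set ℝ}
    (h : IsContinuationOn γ F T) (hγ : ∀ t ∈ T, γ t = γ' t) : IsContinuationOn γ' F T := by
  intro t ht
  refine ⟨hγ t ht ▸ (h t ht).1, ?_⟩
  filter_upwards [(h t ht).2, self_mem_nhdsWithin] with s hs hsT
  rwa [← hγ s hsT]

/-- Stating local constancy as an equivalence treats openness and closedness of `Q` at one stroke.
-/
theorem iff_of_isPreconnected {α : Type*} [TopologicalSpace α] {T : Set α} (hT : IsPreconnected T)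
    {Q : α → Prop} (h : ∀ t ∈ T, ∀ᶠ s in 𝓝[T] t, (Q t ↔ Q s)) {t₀ t : α} (h₀ : t₀ ∈ T)
    (ht : t ∈ T) : Q t₀ ↔ Q t :=
  hT.induction₂ (fun x y => (Q x ↔ Q y)) h (fun _ _ _ _ _ _ h₁ h₂ => h₁.trans h₂)
    (fun _ _ _ _ h₁ => h₁.symm) h₀ ht

/-- Uniqueness of continuation. At times near `t` the families are given by the fixed functions `F
t` and `G t`, and the identity theorem on one connected neighbourhood carries agreement both ways.
Since `t₀` may be later than `t`, the lemma also runs backwards. -/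
theorem IsContinuationOn.eventuallyEq {γ : ℝ → Sphere} (hγ : Continuous γ)
    {F G : ℝ → Sphere → ℂ} {T : Set ℝ} (hF : IsContinuationOn γ F T)
    (hG : IsContinuationOn γ G T) (hT : IsPreconnected T) {t₀ t : ℝ} (h₀ : t₀ ∈ T) (ht : t ∈ T)
    (h : F t₀ =ᶠ[𝓝 (γ t₀)] G t₀) : F t =ᶠ[𝓝 (γ t)] G t := by
  refine (iff_of_isPreconnected (Q := fun t => F t =ᶠ[𝓝 (γ t)] G t) hT ?_ h₀ ht).1 h
  intro t ht
  obtain ⟨V, hVo, hVc, htV, hV⟩ := exists_isPreconnected_nhds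
    ((hF t ht).1.eventually.and (hG t ht).1.eventually)
  have hγV : ∀ᶠ s in 𝓝[T] t, γ s ∈ V :=
    nhdsWithin_le_nhds (hγ.continuousAt.eventually (hVo.mem_nhds htV))
  filter_upwards [(hF t ht).2, (hG t ht).2, hγV] with s hsF hsG hsV
  have key : ∀ {x y}, x ∈ V → y ∈ V → F t =ᶠ[𝓝 x] G t → F t =ᶠ[𝓝 y] G t := fun hx hy =>
    eventuallyEq_of_isPreconnected hVc (fun x hx => (hV hx).1) (fun x hx => (hV hx).2) hx hy
  constructor
  · intro h
    exact (hsF.trans (key htV hsV h)).trans hsG.symm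
  · intro h
    exact key hsV htV ((hsF.symm.trans h).trans hsG)

theorem IsContinuationOn.glue {γ : ℝ → Sphere} (hγ : Continuous γ) {F G : ℝ → Sphere → ℂ}
    {u m v : ℝ} (hF : IsContinuationOn γ F (Icc u m)) (hG : IsContinuationOn γ G (Icc m v))
    (hFG : F m =ᶠ[𝓝 (γ m)] G m) :
    IsContinuationOn γ (fun t => if t ≤ m then F t else G t) (Icc u v) := by
  intro t ht
  rcases lt_trichotomy t m with h | h | h
  · have h1 := hF t ⟨ht.1, h.le⟩
    refine ⟨by simpa [h.le] using h1.1, ?_⟩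
    rw [eventually_nhdsWithin_iff]
    filter_upwards [eventually_nhdsWithin_iff.1 h1.2, gt_mem_nhds h] with s hs hsm hsT
    have : s ≤ m := le_of_lt hsm
    simpa [h.le, this] using hs ⟨hsT.1, this⟩
  · subst h
    have h1 := hF t ⟨ht.1, le_rfl⟩
    have h2 := hG t ⟨le_rfl, ht.2⟩
    refine ⟨by simpa using h1.1, ?_⟩
    rw [eventually_nhdsWithin_iff]
    filter_upwards [eventually_nhdsWithin_iff.1 h1.2, eventually_nhdsWithin_iff.1 h2.2,
      hγ.continuousAt.eventually (eventually_eventually_nhds.2 hFG)] with s hs1 hs2 hs3 hsT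
    by_cases hst : s ≤ t
    · simpa [hst] using hs1 ⟨hsT.1, hst⟩
    · simpa [hst] using (hs2 ⟨(not_le.1 hst).le, hsT.2⟩).trans (EventuallyEq.symm hs3)
  · have h1 := hG t ⟨h.le, ht.2⟩
    refine ⟨by simpa [not_le.2 h] using h1.1, ?_⟩
    rw [eventually_nhdsWithin_iff]
    filter_upwards [eventually_nhdsWithin_iff.1 h1.2, lt_mem_nhds h] with s hs hsm hsT
    have : m ≤ s := le_of_lt hsm
    simpa [not_le.2 h, not_le.2 hsm] using hs ⟨this, hsT.2⟩

theorem isContinuationOn_const {γ : ℝ → Sphere} {Ψ : Sphere → ℂ} {T : Set ℝ}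
    (h : ∀ t ∈ T, RegularAt Ψ (γ t)) : IsContinuationOn γ (fun _ => Ψ) T := fun t ht =>
  ⟨h t ht, Eventually.of_forall fun _ => EventuallyEq.rfl⟩

/-! ### Perturbing a path off a countable set -/

open scoped Manifold ContDiff in
/-- A continuous curve defined on an open set of times can be moved off a countable set of points
of the plane, by an amount controlled by locally admissible radii. -/
theorem exists_avoiding_curve {O : Set ℝ} (hO : IsOpen O) {w : ℝ → ℂ} (hw : ContinuousOn w O)
    {B : Set ℂ} (hB : B.Countable) {Q : ℝ → ℝ → Prop}
    (hQ : ∀ t ∈ O, ∃ ρ > 0, ∀ᶠ s in 𝓝 t, Q s ρ) :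
    ∃ p : ℝ → ℂ, ContinuousOn p O ∧ ∀ s ∈ O, p s ∉ B ∧ ∃ ρ, Q s ρ ∧ dist (p s) (w s) < ρ := by
  let U : TopologicalSpace.Opens ℝ := ⟨O, hO⟩
  have : LocallyCompactSpace U := hO.locallyCompactSpace
  -- A pair `(p, η)` is a position with room to move: the whole disc of radius `η` about `p` is
  -- admissible. The condition is convex, so locally constant choices are patched to a `C¹` one,
  -- although `w` is only continuous.
  let t : U → Set (ℂ × ℝ) := fun s => {q | 0 < q.2 ∧ ∃ ρ, Q s ρ ∧ dist q.1 (w s) + q.2 < ρ}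
  have ht : ∀ s, Convex ℝ (t s) := by
    rintro s ⟨p₁, η₁⟩ ⟨h₁, ρ₁, hQ₁, hρ₁⟩ ⟨p₂, η₂⟩ ⟨h₂, ρ₂, hQ₂, hρ₂⟩ a b ha hb hab
    have hpos : 0 < a * η₁ + b * η₂ := by
      rcases ha.eq_or_lt with rfl | ha'
      · have : b = 1 := by linarith
        simpa [this] using h₂
      · have := mul_pos ha' h₁
        have := mul_nonneg hb h₂.le
        linarith
    have hdist : dist (a • p₁ + b • p₂) (w s) ≤ a * dist p₁ (w s) + b * dist p₂ (w s) := by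
      rw [dist_eq_norm, dist_eq_norm, dist_eq_norm]
      have : a • p₁ + b • p₂ - w s = a • (p₁ - w s) + b • (p₂ - w s) := by
        rw [smul_sub, smul_sub]
        have : w s = a • w s + b • w s := by rw [← add_smul, hab, one_smul]
        nth_rewrite 1 [this]
        abel
      rw [this]
      refine (norm_add_le _ _).trans ?_
      rw [norm_smul, norm_smul, Real.norm_of_nonneg ha, Real.norm_of_nonneg hb]
    have hmax : ∃ ρ, Q s ρ ∧ ρ₁ ≤ ρ ∧ ρ₂ ≤ ρ := by
      rcases le_total ρ₁ ρ₂ with h | h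
      · exact ⟨ρ₂, hQ₂, h, le_rfl⟩
      · exact ⟨ρ₁, hQ₁, le_rfl, h⟩
    obtain ⟨ρ, hQρ, hl₁, hl₂⟩ := hmax
    refine ⟨by simpa using hpos, ρ, hQρ, ?_⟩
    simp only [Prod.fst_add, Prod.smul_fst, Prod.snd_add, Prod.smul_snd, smul_eq_mul]
    refine (add_le_add_left hdist _).trans_lt ?_
    have h3 : 0 < a * (ρ - (dist p₁ (w s) + η₁)) + b * (ρ - (dist p₂ (w s) + η₂)) := by
      rcases ha.eq_or_lt with rfl | ha'
      · have : b = 1 := by linarith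
        rw [this]
        linarith
      · have := mul_pos ha' (show 0 < ρ - (dist p₁ (w s) + η₁) by linarith)
        have := mul_nonneg hb (show 0 ≤ ρ - (dist p₂ (w s) + η₂) by linarith)
        linarith
    have h4 : a * ρ + b * ρ = ρ := by rw [← add_mul, hab, one_mul]
    linarith
  have hloc : ∀ x : U, ∃ q : ℂ × ℝ, ∀ᶠ y in 𝓝 x, q ∈ t y := by
    rintro ⟨x, hx⟩
    obtain ⟨ρ, hρ, hQρ⟩ := hQ x hx
    refine ⟨(w x, ρ / 2), ?_⟩
    have h1 : ∀ᶠ s in 𝓝 x, dist (w x) (w s) < ρ / 2 := by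
      have := (hw.continuousAt (hO.mem_nhds hx)).eventually (Metric.ball_mem_nhds (w x) (half_pos hρ))
      filter_upwards [this] with s hs
      rw [dist_comm]
      exact hs
    have h2 : Tendsto (fun y : U => (y : ℝ)) (𝓝 ⟨x, hx⟩) (𝓝 x) := continuous_subtype_val.continuousAt
    filter_upwards [h2.eventually h1, h2.eventually hQρ] with y hy1 hy2
    exact ⟨half_pos hρ, ρ, hy2, by simpa using by linarith⟩
  obtain ⟨g, hg⟩ := exists_contMDiffMap_forall_mem_convex_of_local_const (n := 1) 𝓘(ℝ, ℝ) ht hloc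
  classical
  let G : ℝ → ℂ × ℝ := fun s => if h : s ∈ O then g ⟨s, h⟩ else 0
  have hG : ∀ s ∈ O, ContDiffAt ℝ 1 G s := by
    intro s hs
    rw [← contMDiffAt_iff_contDiffAt]
    have h1 : ContMDiffAt 𝓘(ℝ, ℝ) 𝓘(ℝ, ℂ × ℝ) 1 (fun x : U => G x) ⟨s, hs⟩ := by
      refine (g.contMDiff ⟨s, hs⟩).congr_of_eventuallyEq (Eventually.of_forall fun x => ?_)
      exact dif_pos x.2
    exact (contMDiffAt_subtype_iff (U := U) (x := ⟨s, hs⟩)).1 h1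
  have hGt : ∀ s ∈ O, 0 < (G s).2 ∧ ∃ ρ, Q s ρ ∧ dist (G s).1 (w s) + (G s).2 < ρ := by
    intro s hs
    have := hg ⟨s, hs⟩
    simpa [G, hs, t] using this
  -- `f b s` is the only `v` for which the displaced position `p + η v` at time `s` equals `b`. As
  -- `s` varies it traces a locally Lipschitz curve, so countably many `b` exclude a set of
  -- dimension at most 1, and some `v` in the unit disc avoids them all.
  let f : ℂ → ℝ → ℂ := fun b s => ((G s).2)⁻¹ • (b - (G s).1)
  have hf : ∀ b, dimH (f b '' O) ≤ 1 := by
    intro b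
    refine (dimH_image_le_of_locally_lipschitzOn fun s hs => ?_).trans
      ((dimH_mono (subset_univ O)).trans Real.dimH_univ.le)
    have h1 : ContDiffAt ℝ 1 (f b) s :=
      ((contDiffAt_snd.comp s (hG s hs)).inv (hGt s hs).1.ne').smul
        (contDiffAt_const.sub (contDiffAt_fst.comp s (hG s hs)))
    obtain ⟨K, t, ht, hK⟩ := h1.exists_lipschitzOnWith
    exact ⟨K, t, mem_nhdsWithin_of_mem_nhds ht, hK⟩
  have hdim : dimH (⋃ b ∈ B, f b '' O) < Module.finrank ℝ ℂ := by
    rw [dimH_bUnion hB, Complex.finrank_real_complex]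
    exact (iSup₂_le fun b _ => hf b).trans_lt (by norm_num)
  obtain ⟨v, hv, hvB⟩ := (dense_compl_of_dimH_lt_finrank hdim).exists_mem_open
    Metric.isOpen_ball ⟨(0 : ℂ), Metric.mem_ball_self one_pos⟩
  refine ⟨fun s => (G s).1 + (G s).2 • v, fun s hs => ?_, fun s hs => ⟨fun hmem => ?_, ?_⟩⟩
  · have := (hG s hs).continuousAt
    exact (this.fst.add (this.snd.smul continuousAt_const)).continuousWithinAt
  · refine hv (mem_iUnion₂.2 ⟨_, hmem, s, hs, ?_⟩)
    simp only [f, add_sub_cancel_left, smul_smul, inv_mul_cancel₀ (hGt s hs).1.ne', one_smul]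
  · obtain ⟨h0, ρ, hQρ, hρ⟩ := hGt s hs
    refine ⟨ρ, hQρ, lt_of_le_of_lt ?_ hρ⟩
    rw [dist_eq_norm, dist_eq_norm, add_sub_right_comm]
    refine (norm_add_le _ _).trans ?_
    gcongr
    rw [norm_smul, Real.norm_of_nonneg h0.le]
    have : ‖v‖ < 1 := by simpa using hvB
    nlinarith

/-- A family of germs along a path can be pushed, within one chart, to a nearby path avoiding a
countable set. -/
theorem exists_perturbation_in_chart {c : ℂ → Sphere} (hc : IsChart c) {A : Set Sphere}
    (hA : A.Countable) {γ : ℝ → Sphere} (hγ : Continuous γ) {F : ℝ → Sphere → ℂ} {u v : ℝ}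
    {T : Set ℝ} (hT : Ioo u v ⊆ T) (hF : IsContinuationOn γ F T) :
    ∃ (γ' : ℝ → Sphere) (F' : ℝ → Sphere → ℂ), Continuous γ' ∧ IsContinuationOn γ' F' T ∧
      (∀ t, (t ∈ Ioo u v → γ t ∉ range c) → γ' t = γ t ∧ F' t = F t) ∧
      (∀ t ∈ Ioo u v, γ t ∈ range c → γ' t ∉ A) ∧
      ∀ t ∉ Ioo u v, ∀ Ψ, RegularAt Ψ (γ t) →
        ∀ᶠ s in 𝓝 t, F' s =ᶠ[𝓝 (γ' s)] Ψ → F s =ᶠ[𝓝 (γ s)] Ψ := by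
  classical
  let O : Set ℝ := {t | t ∈ Ioo u v ∧ γ t ∈ range c}
  have hO : IsOpen O := isOpen_Ioo.inter (hc.isOpenEmbedding.isOpen_range.preimage hγ)
  have hOc : (Oᶜ).Nonempty := ⟨u, fun h => lt_irrefl _ h.1.1⟩
  have hOT : ∀ t ∈ O, T ∈ 𝓝 t := fun t ht => mem_of_superset (isOpen_Ioo.mem_nhds ht.1) hT
  have hTO : ∀ t ∈ O, t ∈ T := fun t ht => hT ht.1
  let w : ℝ → ℂ := fun t => Function.invFun c (γ t)
  have hcw : ∀ t ∈ O, c (w t) = γ t := fun t ht => Function.invFun_eq ht.2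
  have hw : ∀ t ∈ O, ContinuousAt w t := by
    intro t ht
    rw [hc.isOpenEmbedding.isEmbedding.isInducing.continuousAt_iff]
    refine hγ.continuousAt.congr ?_
    filter_upwards [hO.mem_nhds ht] with s hs
    exact (hcw s hs).symm
  -- The displacement at time `t` is kept below the distance from `t` to the complement of `O`. It
  -- therefore tends to zero where the chart or the time interval is left, which makes the new path
  -- continuous there.
  let ε : ℝ → ℝ := fun t => Metric.infDist t Oᶜ
  have hεc : Continuous ε := Metric.continuous_infDist_pt _
  have hε0 : ∀ t ∉ O, ε t = 0 := fun t ht => Metric.infDist_zero_of_mem ht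
  have hεpos : ∀ t ∈ O, 0 < ε t := fun t ht =>
    (hO.isClosed_compl.notMem_iff_infDist_pos hOc).1 (not_not.2 ht)
  -- Admissible radii: one holomorphic function represents the germ on the whole disc, so the germ
  -- may be moved to any point of it.
  let Q : ℝ → ℝ → Prop := fun s ρ => ∃ Φ : Sphere → ℂ,
    (∀ z ∈ Metric.ball (w s) ρ, RegularAt Φ (c z)) ∧ Φ =ᶠ[𝓝 (γ s)] F s ∧
    ∀ z ∈ Metric.ball (w s) ρ, dist (c z) (γ s) < ε s
  have hQ : ∀ t ∈ O, ∃ ρ > 0, ∀ᶠ s in 𝓝 t, Q s ρ := by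
    intro t ht
    have h1 : ∀ᶠ z in 𝓝 (w t), RegularAt (F t) (c z) ∧ dist (c z) (γ t) < ε t / 3 := by
      rw [← hc.eventually_iff (p := fun x => RegularAt (F t) x ∧ dist x (γ t) < ε t / 3), hcw t ht]
      exact (hF t (hTO t ht)).1.eventually.and
        (Metric.ball_mem_nhds _ (by have := hεpos t ht; linarith))
    obtain ⟨r, hr, hr1⟩ := Metric.eventually_nhds_iff_ball.1 h1
    refine ⟨r / 2, half_pos hr, ?_⟩
    have h2 : ∀ᶠ s in 𝓝 t, F s =ᶠ[𝓝 (γ s)] F t := by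
      have := (hF t (hTO t ht)).2
      rwa [nhdsWithin_eq_nhds.2 (hOT t ht)] at this
    have h3 : ∀ᶠ s in 𝓝 t, dist (w s) (w t) < r / 2 :=
      (hw t ht).eventually (Metric.ball_mem_nhds _ (half_pos hr))
    have h4 : ∀ᶠ s in 𝓝 t, dist (γ s) (γ t) < ε t / 3 :=
      hγ.continuousAt.eventually (Metric.ball_mem_nhds _ (by have := hεpos t ht; linarith))
    have h5 : ∀ᶠ s in 𝓝 t, 2 * ε t / 3 < ε s :=
      hεc.continuousAt.eventually (lt_mem_nhds (by have := hεpos t ht; linarith))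
    filter_upwards [h2, h3, h4, h5] with s hs2 hs3 hs4 hs5
    have hsub : ∀ z ∈ Metric.ball (w s) (r / 2), z ∈ Metric.ball (w t) r := fun z hz => by
      have := dist_triangle z (w s) (w t)
      rw [Metric.mem_ball] at hz ⊢
      linarith
    refine ⟨F t, fun z hz => (hr1 z (hsub z hz)).1, hs2.symm, fun z hz => ?_⟩
    have h6 := (hr1 z (hsub z hz)).2
    have := dist_triangle (c z) (γ t) (γ s)
    rw [dist_comm (γ t)] at this
    linarith
  obtain ⟨p, hp, hpO⟩ := exists_avoiding_curve hO (fun t ht => (hw t ht).continuousWithinAt)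
    (hA.preimage_of_injOn hc.isOpenEmbedding.injective.injOn) hQ
  choose! ρ hρ using fun s hs => (hpO s hs).2
  choose! Φ hΦreg hΦF hΦd using fun s hs => (hρ s hs).1
  have hpρ : ∀ s ∈ O, p s ∈ Metric.ball (w s) (ρ s) := fun s hs => (hρ s hs).2
  have hρpos : ∀ s ∈ O, 0 < ρ s := fun s hs => dist_nonneg.trans_lt (hρ s hs).2
  have hpc : ∀ t ∈ O, ContinuousAt p t := fun t ht => hp.continuousAt (hO.mem_nhds ht)
  let γ' : ℝ → Sphere := fun t => if t ∈ O then c (p t) else γ t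
  let F' : ℝ → Sphere → ℂ := fun t => if t ∈ O then Φ t else F t
  have hγO : ∀ t ∈ O, γ' t = c (p t) := fun t ht => if_pos ht
  have hFO : ∀ t ∈ O, F' t = Φ t := fun t ht => if_pos ht
  have hγn : ∀ t ∉ O, γ' t = γ t := fun t ht => if_neg ht
  have hFn : ∀ t ∉ O, F' t = F t := fun t ht => if_neg ht
  have hdist : ∀ s, dist (γ' s) (γ s) ≤ ε s := by
    intro s
    by_cases hs : s ∈ O
    · rw [hγO s hs]
      exact (hΦd s hs _ (hpρ s hs)).le
    · rw [hγn s hs, dist_self, hε0 s hs]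
  have hγ'c : Continuous γ' := by
    rw [continuous_iff_continuousAt]
    intro t
    by_cases ht : t ∈ O
    · refine (hc.isOpenEmbedding.continuous.continuousAt.comp (hpc t ht)).congr ?_
      filter_upwards [hO.mem_nhds ht] with s hs
      exact (hγO s hs).symm
    · have h1 : Tendsto (fun s => dist (γ' s) (γ s)) (𝓝 t) (𝓝 0) := by
        refine squeeze_zero (fun _ => dist_nonneg) hdist ?_
        rw [← hε0 t ht]
        exact hεc.continuousAt
      have h2 : Tendsto (fun s => dist (γ s) (γ t)) (𝓝 t) (𝓝 0) :=
        tendsto_iff_dist_tendsto_zero.1 hγ.continuousAt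
      change Tendsto γ' (𝓝 t) (𝓝 (γ' t))
      rw [hγn t ht, tendsto_iff_dist_tendsto_zero]
      refine squeeze_zero (fun _ => dist_nonneg) (fun s => dist_triangle _ (γ s) _) ?_
      simpa using h1.add h2
  -- near a time outside `O`, the small discs lie in any given neighbourhood
  have hshrink : ∀ t ∉ O, ∀ V ∈ 𝓝 (γ t), ∀ᶠ s in 𝓝 t, s ∈ O → ∀ z ∈ Metric.ball (w s) (ρ s), c z ∈ V := by
    intro t ht V hV
    obtain ⟨r, hr, hrV⟩ := Metric.mem_nhds_iff.1 hV
    have h4 : ∀ᶠ s in 𝓝 t, dist (γ s) (γ t) < r / 2 :=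
      hγ.continuousAt.eventually (Metric.ball_mem_nhds _ (half_pos hr))
    have h5 : ∀ᶠ s in 𝓝 t, ε s < r / 2 :=
      hεc.continuousAt.eventually (gt_mem_nhds (by rw [hε0 t ht]; exact half_pos hr))
    filter_upwards [h4, h5] with s hs4 hs5 hsO z hz
    have h6 := hΦd s hsO z hz
    have := dist_triangle (c z) (γ s) (γ t)
    exact hrV (Metric.mem_ball.2 (by linarith))
  -- and there the germs before and after the perturbation are continuations of each other
  have htransfer : ∀ t ∉ O, ∀ Ψ, RegularAt Ψ (γ t) → ∀ᶠ s in 𝓝 t,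
      (F s =ᶠ[𝓝 (γ s)] Ψ ↔ F' s =ᶠ[𝓝 (γ' s)] Ψ) := by
    intro t ht Ψ hΨ
    filter_upwards [hshrink t ht _ hΨ.eventually] with s hs
    by_cases hsO : s ∈ O
    · rw [hFO s hsO, hγO s hsO]
      have hC : IsPreconnected (c '' Metric.ball (w s) (ρ s)) :=
        (convex_ball _ _).isPreconnected.image _ hc.isOpenEmbedding.continuous.continuousOn
      have key : ∀ {x y}, x ∈ c '' Metric.ball (w s) (ρ s) → y ∈ c '' Metric.ball (w s) (ρ s) →
          Φ s =ᶠ[𝓝 x] Ψ → Φ s =ᶠ[𝓝 y] Ψ := by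
        refine fun hx hy => eventuallyEq_of_isPreconnected hC ?_ ?_ hx hy
        · rintro _ ⟨z, hz, rfl⟩
          exact hΦreg s hsO z hz
        · rintro _ ⟨z, hz, rfl⟩
          exact hs hsO z hz
      have hx : γ s ∈ c '' Metric.ball (w s) (ρ s) :=
        ⟨w s, Metric.mem_ball_self (hρpos s hsO), hcw s hsO⟩
      have hy : c (p s) ∈ c '' Metric.ball (w s) (ρ s) := ⟨p s, hpρ s hsO, rfl⟩
      exact ⟨fun h => key hx hy ((hΦF s hsO).trans h),
        fun h => (hΦF s hsO).symm.trans (key hy hx h)⟩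
    · rw [hFn s hsO, hγn s hsO]
  refine ⟨γ', F', hγ'c, ?_, fun t ht => ?_, fun t ht htc => ?_, fun t ht Ψ hΨ => ?_⟩
  · intro t htT
    by_cases ht : t ∈ O
    · rw [hFO t ht, hγO t ht]
      refine ⟨hΦreg t ht _ (hpρ t ht), ?_⟩
      have h2 : ∀ᶠ s in 𝓝 t, F s =ᶠ[𝓝 (γ s)] F t := by
        have := (hF t (hTO t ht)).2
        rwa [nhdsWithin_eq_nhds.2 (hOT t ht)] at this
      have h3 : ∀ᶠ s in 𝓝 t, Φ t =ᶠ[𝓝 (γ s)] F t :=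
        hγ.continuousAt.eventually (eventually_eventually_nhds.2 (hΦF t ht))
      have h4 : ∀ᶠ s in 𝓝 t, w s ∈ Metric.ball (w t) (ρ t) :=
        (hw t ht).eventually (Metric.ball_mem_nhds _ (hρpos t ht))
      have h5 : ∀ᶠ s in 𝓝 t, p s ∈ Metric.ball (w t) (ρ t) :=
        (hpc t ht).eventually (Metric.isOpen_ball.mem_nhds (hpρ t ht))
      refine nhdsWithin_le_nhds ?_
      filter_upwards [h2, h3, h4, h5, hO.mem_nhds ht] with s hs2 hs3 hs4 hs5 hsO
      rw [hFO s hsO, hγO s hsO]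
      -- `Φ s` and `Φ t` are compared on the intersection of their discs, which is convex and
      -- contains both the old position `w s` and the new one `p s`.
      have hC : IsPreconnected (c '' (Metric.ball (w s) (ρ s) ∩ Metric.ball (w t) (ρ t))) :=
        ((convex_ball _ _).inter (convex_ball _ _)).isPreconnected.image _
          hc.isOpenEmbedding.continuous.continuousOn
      refine eventuallyEq_of_isPreconnected hC ?_ ?_
        ⟨w s, ⟨Metric.mem_ball_self (hρpos s hsO), hs4⟩, rfl⟩
        ⟨p s, ⟨hpρ s hsO, hs5⟩, rfl⟩ ?_
      · rintro _ ⟨z, hz, rfl⟩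
        exact hΦreg s hsO z hz.1
      · rintro _ ⟨z, hz, rfl⟩
        exact hΦreg t ht z hz.2
      · rw [hcw s hsO]
        exact ((hΦF s hsO).trans hs2).trans (EventuallyEq.symm hs3)
    · rw [hFn t ht, hγn t ht]
      refine ⟨(hF t htT).1, ?_⟩
      filter_upwards [(hF t htT).2,
        nhdsWithin_le_nhds (htransfer t ht (F t) (hF t htT).1)] with s hs1 hs2
      exact hs2.1 hs1
  · have ht' : t ∉ O := fun h => ht h.1 h.2
    exact ⟨hγn t ht', hFn t ht'⟩
  · rw [hγO t ⟨ht, htc⟩]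
    exact (hpO t ⟨ht, htc⟩).1
  -- This direction brings a limit germ found along the perturbed path back to the original one.
  · filter_upwards [htransfer t (fun h => ht h.1) Ψ hΨ] with s hs
    exact hs.2

/-- A family of germs along a path can be pushed to a nearby path with the same ends avoiding a
countable set in between. -/
theorem exists_perturbation {A : Set Sphere} (hA : A.Countable) {γ : ℝ → Sphere}
    (hγ : Continuous γ) {F : ℝ → Sphere → ℂ} {u v : ℝ} {T : Set ℝ} (hT : Ioo u v ⊆ T)
    (hF : IsContinuationOn γ F T) :
    ∃ (γ' : ℝ → Sphere) (F' : ℝ → Sphere → ℂ), Continuous γ' ∧ IsContinuationOn γ' F' T ∧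
      (∀ t ∉ Ioo u v, γ' t = γ t ∧ F' t = F t) ∧ (∀ t ∈ Ioo u v, γ' t ∉ A) ∧
      ∀ t ∉ Ioo u v, ∀ Ψ, RegularAt Ψ (γ t) →
        ∀ᶠ s in 𝓝 t, F' s =ᶠ[𝓝 (γ' s)] Ψ → F s =ᶠ[𝓝 (γ s)] Ψ := by
  obtain ⟨γ₁, F₁, hγ₁, hF₁, he₁, hA₁, ht₁⟩ := exists_perturbation_in_chart isChart_coe hA hγ hT hF
  obtain ⟨γ₂, F₂, hγ₂, hF₂, he₂, hA₂, ht₂⟩ :=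
    exists_perturbation_in_chart isChart_chartInfty hA hγ₁ hT hF₁
  refine ⟨γ₂, F₂, hγ₂, hF₂, fun t ht => ?_, fun t ht => ?_, fun t ht Ψ hΨ => ?_⟩
  · obtain ⟨h1, h2⟩ := he₁ t fun h => absurd h ht
    obtain ⟨h3, h4⟩ := he₂ t fun h => absurd h ht
    exact ⟨h3.trans h1, h4.trans h2⟩
  -- A point left in place by the second move is outside the chart at infinity. It was handled by
  -- the first move: otherwise it would be the unmoved `γ t`, outside both charts.
  · by_cases h : γ₁ t ∈ range chartInfty
    · exact hA₂ t ht h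
    · rw [(he₂ t fun _ => h).1]
      refine hA₁ t ht (by_contra fun h' => ?_)
      rw [(he₁ t fun _ => h').1] at h
      exact (mem_range_coe_or_mem_range_chartInfty (γ t)).elim h' h
  · have h1 := (he₁ t fun h => absurd h ht).1
    filter_upwards [ht₁ t ht Ψ hΨ, ht₂ t ht Ψ (by rwa [h1])] with s hs1 hs2
    exact hs1 ∘ hs2

theorem IsContinuationOn.comp {γ : ℝ → Sphere} {F : ℝ → Sphere → ℂ} {T T' : Set ℝ}
    (hF : IsContinuationOn γ F T) {k : ℝ → ℝ} (hk : Continuous k) (hT : MapsTo k T' T) :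
    IsContinuationOn (fun t => γ (k t)) (fun t => F (k t)) T' := fun _ ht =>
  ⟨(hF _ (hT ht)).1, (hk.continuousWithinAt.tendsto_nhdsWithin hT).eventually (hF _ (hT ht)).2⟩

/-! ### Forbidden sets -/

/-- The germ of `φ` at `a` continues along every path from `a` that does not meet `A`, except
possibly at its initial point. -/
def IsForbidden (A : Set Sphere) (a : Sphere) (φ : Sphere → ℂ) : Prop :=
  ∀ γ : ℝ → Sphere, Continuous γ → ∀ u v : ℝ, u ≤ v → γ u = a → (∀ t ∈ Ioc u v, γ t ∉ A) →
    ∃ F, F u =ᶠ[𝓝 a] φ ∧ IsContinuationOn γ F (Icc u v)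

theorem IsForbidden.mono {A B : Set Sphere} {a : Sphere} {φ : Sphere → ℂ} (h : IsForbidden A a φ)
    (hAB : A ⊆ B) : IsForbidden B a φ := fun γ hγ u v huv ha hB =>
  h γ hγ u v huv ha fun t ht hA => hB t ht (hAB hA)

theorem IsForbidden.congr {A : Set Sphere} {a : Sphere} {φ ψ : Sphere → ℂ}
    (h : IsForbidden A a φ) (e : φ =ᶠ[𝓝 a] ψ) : IsForbidden A a ψ := by
  intro γ hγ u v huv ha hA
  obtain ⟨F, hF, hF'⟩ := h γ hγ u v huv ha hA
  exact ⟨F, hF.trans e, hF'⟩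

/-- The germ of `ψ` at `b` is a continuation of the germ of `φ` at `a` along a real-time path. -/
def Reaches (a : Sphere) (φ : Sphere → ℂ) (b : Sphere) (ψ : Sphere → ℂ) : Prop :=
  ∃ (γ : ℝ → Sphere) (F : ℝ → Sphere → ℂ) (u v : ℝ), Continuous γ ∧ u ≤ v ∧ γ u = a ∧ γ v = b ∧
    IsContinuationOn γ F (Icc u v) ∧ F u =ᶠ[𝓝 a] φ ∧ F v =ᶠ[𝓝 b] ψ

theorem IsContinuation.isContinuationOn {a b : Sphere} {γ : Path a b} {τ : I} {φ : Sphere → ℂ}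
    {F : I → Sphere → ℂ} (h : IsContinuation γ τ φ F) :
    IsContinuationOn γ.extend (fun t => F (projIcc 0 1 zero_le_one t)) (Icc 0 τ) := by
  intro t ht
  have hle : ∀ {s : ℝ}, s ∈ Icc 0 (τ : ℝ) → projIcc 0 1 zero_le_one s ≤ τ := fun {s} hs => by
    rw [projIcc_of_mem zero_le_one ⟨hs.1, hs.2.trans τ.2.2⟩]
    exact hs.2
  obtain ⟨h1, h2⟩ := h.2 _ (hle ht)
  refine ⟨h1, ?_⟩
  filter_upwards [nhdsWithin_le_nhds ((continuous_projIcc (h := zero_le_one)).continuousAt.eventually h2),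
    self_mem_nhdsWithin] with s hs hsT
  exact hs (hle hsT)

theorem IsContinuationOn.isContinuation {a b : Sphere} {γ : Path a b} {φ : Sphere → ℂ}
    {F : ℝ → Sphere → ℂ} (h : IsContinuationOn γ.extend F (Icc 0 1)) (h0 : F 0 =ᶠ[𝓝 a] φ) :
    IsContinuation γ 1 φ (fun t => F t) := by
  refine ⟨h0, fun t _ => ?_⟩
  obtain ⟨h1, h2⟩ := h t t.2
  rw [Path.extend_apply γ t.2] at h1
  refine ⟨h1, ?_⟩
  have h3 := (continuous_subtype_val (p := fun x : ℝ => x ∈ I)).continuousAt.eventually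
    (eventually_nhdsWithin_iff.1 h2)
  filter_upwards [h3] with s hs _
  simpa [Path.extend_apply γ s.2] using hs s.2

theorem Equivalent.reaches {a b : Sphere} {φ ψ : Sphere → ℂ} (h : Equivalent a φ b ψ) :
    Reaches a φ b ψ := by
  obtain ⟨γ, F, hF, h1⟩ := h
  refine ⟨γ.extend, _, 0, 1, γ.continuous_extend, zero_le_one, γ.extend_zero, γ.extend_one,
    hF.isContinuationOn, ?_, ?_⟩
  · simpa using hF.1
  · simpa using h1

theorem Reaches.regularAt {a b : Sphere} {φ ψ : Sphere → ℂ} (h : Reaches a φ b ψ) :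
    RegularAt ψ b := by
  obtain ⟨γ, F, u, v, -, huv, -, rfl, hF, -, h1⟩ := h
  exact (hF v ⟨huv, le_rfl⟩).1.congr h1

/-- A countable forbidden set of a germ is forbidden for all its continuations. -/
theorem IsForbidden.of_reaches {A : Set Sphere} (hA : A.Countable) {a b : Sphere}
    {φ ψ : Sphere → ℂ} (h : IsForbidden A a φ) (hr : Reaches a φ b ψ) : IsForbidden A b ψ := by
  have hψ := hr.regularAt
  obtain ⟨γ, F, u₀, v₀, hγ, huv₀, rfl, rfl, hF, hφ, hψF⟩ := hr
  intro δ hδ u v huv hu hδA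
  rcases huv.eq_or_lt with rfl | huv
  · refine ⟨fun _ => ψ, EventuallyEq.rfl, isContinuationOn_const fun t ht => ?_⟩
    obtain rfl : t = u := le_antisymm ht.2 ht.1
    rwa [hu]
  -- a short initial piece of `δ` stays where `ψ` is regular
  obtain ⟨m, hum, hmv, hm⟩ : ∃ m, u < m ∧ m ≤ v ∧ ∀ t ∈ Icc u m, RegularAt ψ (δ t) := by
    have h1 : ∀ᶠ t in 𝓝 u, RegularAt ψ (δ t) :=
      hδ.continuousAt.eventually (by rw [hu]; exact hψ.eventually)
    obtain ⟨r, hr, hr1⟩ := Metric.eventually_nhds_iff_ball.1 h1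
    refine ⟨min v (u + r / 2), lt_min huv (by linarith), min_le_left _ _, fun t ht => hr1 t ?_⟩
    have := ht.2.trans (min_le_right _ _)
    rw [Metric.mem_ball, Real.dist_eq, abs_of_nonneg (by linarith [ht.1])]
    linarith
  set u₁ := u - v₀ + u₀ with hu₁
  have hu₁u : u₁ ≤ u := by linarith
  -- `γ` is shifted so as to end at time `u` and followed by `δ`. The point `κ u` may lie in `A`, so
  -- the perturbation spans `(u₁, m)`, past `u`, and rejoins `δ` at time `m`, where `A` is already
  -- avoided.
  let κ : ℝ → Sphere := fun t => if t ≤ u then γ (t - u + v₀) else δ t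
  have hκ : Continuous κ := by
    refine Continuous.if_le (by fun_prop) hδ continuous_id continuous_const ?_
    rintro t rfl
    simp [hu]
  have hκγ : ∀ t ≤ u, κ t = γ (t - u + v₀) := fun t ht => if_pos ht
  have hκδ : ∀ t, u ≤ t → κ t = δ t := by
    intro t ht
    rcases ht.eq_or_lt with rfl | ht
    · rw [hκγ _ le_rfl, hu]
      simp
    · exact if_neg (not_le.2 ht)
  have hG1 : IsContinuationOn κ (fun t => F (t - u + v₀)) (Icc u₁ u) := by
    refine (hF.comp (k := fun t => t - u + v₀) (by fun_prop) ?_).congr_path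
      fun t ht => (hκγ t ht.2).symm
    intro t ht
    constructor <;> linarith [ht.1, ht.2]
  have hG2 : IsContinuationOn κ (fun _ => ψ) (Icc u m) :=
    isContinuationOn_const fun t ht => by rw [hκδ t ht.1]; exact hm t ht
  have hG := hG1.glue hκ hG2 (by
    rw [hκδ u le_rfl, hu]
    simpa using hψF)
  obtain ⟨κ', G', hκ', hG', he, hA', -⟩ := exists_perturbation hA hκ Ioo_subset_Icc_self hG
  have hu₁m : u₁ < m := hu₁u.trans_lt hum
  have hm' := he m (fun h => lt_irrefl _ h.2)
  have hu' := he u₁ (fun h => lt_irrefl _ h.1)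
  rw [hκδ m hum.le] at hm'
  let κ₂ : ℝ → Sphere := fun t => if t ≤ m then κ' t else δ t
  have hκ₂ : Continuous κ₂ := by
    refine Continuous.if_le hκ' hδ continuous_id continuous_const ?_
    rintro t rfl
    exact hm'.1
  have hκ₂κ : ∀ t ≤ m, κ₂ t = κ' t := fun t ht => if_pos ht
  have hκ₂δ : ∀ t, m ≤ t → κ₂ t = δ t := by
    intro t ht
    rcases ht.eq_or_lt with rfl | ht
    · rw [hκ₂κ _ le_rfl, hm'.1]
    · exact if_neg (not_le.2 ht)
  have hstart : κ₂ u₁ = γ u₀ := by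
    rw [hκ₂κ _ hu₁m.le, hu'.1, hκγ _ hu₁u]
    congr 1
    linarith
  obtain ⟨H, hH0, hH⟩ := h κ₂ hκ₂ u₁ v (hu₁m.le.trans hmv) hstart (by
    intro t ht
    rcases lt_or_ge t m with h | h
    · rw [hκ₂κ t h.le]
      exact hA' t ⟨ht.1, h⟩
    · rw [hκ₂δ t h]
      exact hδA t ⟨hum.trans_le h, ht.2⟩)
  -- This is uniqueness along the perturbed path; thus `ψ` up to time `m` and `H` afterwards form a
  -- continuation along `δ` itself.
  have hHm : H m =ᶠ[𝓝 (δ m)] ψ := by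
    have h1 : IsContinuationOn κ₂ G' (Icc u₁ m) :=
      hG'.congr_path fun t ht => (hκ₂κ t ht.2).symm
    have h2 := IsContinuationOn.eventuallyEq hκ₂ (hH.mono (Icc_subset_Icc_right hmv)) h1
      isPreconnected_Icc (left_mem_Icc.2 hu₁m.le) (right_mem_Icc.2 hu₁m.le) (by
        rw [hstart, hu'.2, if_pos hu₁u]
        refine hH0.trans (hφ.symm.trans ?_)
        rw [show u₁ - u + v₀ = u₀ by linarith])
    rw [hκ₂δ m le_rfl, hm'.2, if_neg (not_le.2 hum)] at h2
    exact h2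
  have hfin := IsContinuationOn.glue hδ (F := fun _ => ψ) (G := H) (u := u) (m := m) (v := v)
    (isContinuationOn_const hm)
    ((hH.mono (Icc_subset_Icc_left hu₁m.le)).congr_path fun t ht => hκ₂δ t ht.1) hHm.symm
  refine ⟨_, ?_, hfin⟩
  simp [hum.le]

/-- Continuations over all `[0, r]`, `r < 1`, fit together. -/
theorem exists_isContinuationOn_Ico {γ : ℝ → Sphere} (hγ : Continuous γ) {φ : Sphere → ℂ}
    (h : ∀ r ∈ Ico (0 : ℝ) 1, ∃ F, F 0 =ᶠ[𝓝 (γ 0)] φ ∧ IsContinuationOn γ F (Icc 0 r)) :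
    ∃ F, F 0 =ᶠ[𝓝 (γ 0)] φ ∧ IsContinuationOn γ F (Ico 0 1) := by
  choose! G hG0 hG using h
  -- The diagonal family; near `t` it agrees with the single continuation `G r` for a fixed `r > t`.
  refine ⟨fun t => G t t, hG0 0 ⟨le_rfl, one_pos⟩, fun t ht => ⟨(hG t ht t ⟨ht.1, le_rfl⟩).1, ?_⟩⟩
  obtain ⟨r, htr, hr1⟩ := exists_between ht.2
  have hr : r ∈ Ico (0 : ℝ) 1 := ⟨ht.1.trans htr.le, hr1⟩
  have key : ∀ s ∈ Icc 0 r, G s s =ᶠ[𝓝 (γ s)] G r s := fun s hs => by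
    have hs1 : s ∈ Ico (0 : ℝ) 1 := ⟨hs.1, hs.2.trans_lt hr1⟩
    exact IsContinuationOn.eventuallyEq hγ (hG s hs1) ((hG r hr).mono (Icc_subset_Icc_right hs.2))
      isPreconnected_Icc (left_mem_Icc.2 hs.1) (right_mem_Icc.2 hs.1)
      ((hG0 s hs1).trans (hG0 r hr).symm)
  have h1 := eventually_nhdsWithin_iff.1 (hG r hr t ⟨ht.1, htr.le⟩).2
  rw [eventually_nhdsWithin_iff]
  filter_upwards [h1, gt_mem_nhds htr, hγ.continuousAt.eventually
    (eventually_eventually_nhds.2 (key t ⟨ht.1, htr.le⟩))] with s hs1 hsr hs2 hsT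
  have hs : s ∈ Icc 0 r := ⟨hsT.1, hsr.le⟩
  exact (key s hs).trans ((hs1 hs).trans (EventuallyEq.symm hs2))

/-- Singular points belong to every countable forbidden set. -/
theorem IsForbidden.mem_of_isSingularPoint {A : Set Sphere} (hA : A.Countable) {a b : Sphere}
    {φ : Sphere → ℂ} (h : IsForbidden A a φ) (hs : IsSingularPoint a φ b) : b ∈ A := by
  obtain ⟨γ, hno, hτ⟩ := hs
  by_contra hb
  refine hno ?_
  have hγ := γ.continuous_extend
  have h0 : γ.extend 0 = a := γ.extend_zero
  have h1 : γ.extend 1 = b := γ.extend_one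
  obtain ⟨F, hF0, hF⟩ := exists_isContinuationOn_Ico hγ (φ := φ) (fun r hr => by
    obtain ⟨F, hF⟩ := hτ ⟨r, hr.1, hr.2.le⟩ hr.2
    refine ⟨_, ?_, hF.isContinuationOn⟩
    rw [h0]
    simpa using hF.1)
  -- Off `A` the germ continues through time 1, since `b ∉ A`. The germ reached there, transferred
  -- back to `γ`, is the missing last one.
  obtain ⟨γ', F', hγ', hF', he, hA', hend⟩ := exists_perturbation hA hγ Ioo_subset_Ico_self hF
  have he0 := he 0 (fun h => lt_irrefl _ h.1)
  have he1 := he 1 (fun h => lt_irrefl _ h.2)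
  obtain ⟨G, hG0, hG⟩ := h γ' hγ' 0 1 zero_le_one (he0.1.trans h0) (by
    intro t ht
    rcases ht.2.eq_or_lt with rfl | ht1
    · rwa [he1.1, h1]
    · exact hA' t ⟨ht.1, ht1⟩)
  have hG1 := hG 1 (right_mem_Icc.2 zero_le_one)
  have hGF : ∀ s ∈ Ico (0 : ℝ) 1, G s =ᶠ[𝓝 (γ' s)] F' s := fun s hs =>
    IsContinuationOn.eventuallyEq hγ' (hG.mono Ico_subset_Icc_self) hF' isPreconnected_Ico
      (left_mem_Ico.2 one_pos) hs (by
        rw [he0.1, he0.2, h0]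
        rw [h0] at hF0
        exact hG0.trans hF0.symm)
  have hlim : ∀ᶠ s in 𝓝 (1 : ℝ), s ∈ Ico (0 : ℝ) 1 → F s =ᶠ[𝓝 (γ.extend s)] G 1 := by
    filter_upwards [hend 1 (fun h => lt_irrefl _ h.2) (G 1) (by rw [← he1.1]; exact hG1.1),
      eventually_nhdsWithin_iff.1 hG1.2] with s hs1 hs2 hsT
    exact hs1 ((hGF s hsT).symm.trans (hs2 ⟨hsT.1, hsT.2.le⟩))
  refine ⟨_, IsContinuationOn.isContinuation (F := fun t => if t < 1 then F t else G 1) ?_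
    (by simpa [h0] using hF0)⟩
  intro t ht
  rcases ht.2.eq_or_lt with rfl | ht1
  · refine ⟨by simpa [← he1.1] using hG1.1, ?_⟩
    filter_upwards [nhdsWithin_le_nhds hlim, self_mem_nhdsWithin] with s hs hsT
    by_cases hs1 : s < 1
    · simpa [hs1] using hs ⟨hsT.1, hs1⟩
    · simp [hs1]
  · obtain ⟨h3, h4⟩ := hF t ⟨ht.1, ht1⟩
    refine ⟨by simpa [ht1] using h3, ?_⟩
    rw [eventually_nhdsWithin_iff] at h4 ⊢
    filter_upwards [h4, gt_mem_nhds ht1] with s hs hs1 hsT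
    have hs1' : s < 1 := hs1
    simpa [ht1, hs1'] using hs ⟨hsT.1, hs1⟩

/-! ### Countability of the set of germs -/

/-- Chart images of discs with centres in a dense sequence and radii `1 / (n + 1)`. Connectedness
makes a germ determine a regular function on such a set. -/
theorem exists_countable_isPreconnected_basis :
    ∃ S : Set (Set Sphere), S.Countable ∧ (∀ V ∈ S, IsOpen V ∧ IsPreconnected V) ∧
      ∀ (a : Sphere), ∀ U ∈ 𝓝 a, ∃ V ∈ S, a ∈ V ∧ V ⊆ U := by
  let B : (ℂ → Sphere) → ℕ × ℕ → Set Sphere := fun c q =>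
    c '' Metric.ball (TopologicalSpace.denseSeq ℂ q.1) (1 / (q.2 + 1))
  have hB : ∀ c, IsChart c → ∀ q, IsOpen (B c q) ∧ IsPreconnected (B c q) := fun c hc q =>
    ⟨hc.isOpenEmbedding.isOpenMap _ Metric.isOpen_ball,
      (convex_ball _ _).isPreconnected.image _ hc.isOpenEmbedding.continuous.continuousOn⟩
  have hbasis : ∀ c, IsChart c → ∀ z, ∀ U ∈ 𝓝 (c z), ∃ q, c z ∈ B c q ∧ B c q ⊆ U := by
    intro c hc z U hU
    obtain ⟨r, hr, hrU⟩ := Metric.eventually_nhds_iff_ball.1 (hc.eventually_iff.1 hU)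
    obtain ⟨n, hn⟩ := exists_nat_one_div_lt (half_pos hr)
    obtain ⟨k, hk⟩ := (TopologicalSpace.denseRange_denseSeq ℂ).exists_dist_lt z
      (Nat.one_div_pos_of_nat (n := n) (α := ℝ))
    refine ⟨(k, n), ⟨z, Metric.mem_ball.2 hk, rfl⟩, ?_⟩
    rintro _ ⟨w, hw, rfl⟩
    refine hrU w (Metric.mem_ball.2 ?_)
    have h1 : dist w (TopologicalSpace.denseSeq ℂ k) < 1 / ((n : ℝ) + 1) := hw
    have := dist_triangle_right w z (TopologicalSpace.denseSeq ℂ k)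
    linarith
  refine ⟨range (B fun z : ℂ => (z : Sphere)) ∪ range (B chartInfty),
    (countable_range _).union (countable_range _), ?_, fun a U hU => ?_⟩
  · rintro _ (⟨q, rfl⟩ | ⟨q, rfl⟩)
    · exact hB _ isChart_coe q
    · exact hB _ isChart_chartInfty q
  · rcases mem_range_coe_or_mem_range_chartInfty a with ⟨z, rfl⟩ | ⟨z, rfl⟩
    · obtain ⟨q, hq⟩ := hbasis _ isChart_coe z U hU
      exact ⟨_, Or.inl ⟨q, rfl⟩, hq⟩
    · obtain ⟨q, hq⟩ := hbasis _ isChart_chartInfty z U hU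
      exact ⟨_, Or.inr ⟨q, rfl⟩, hq⟩

/-- The Poincaré–Volterra theorem: countably many functions represent all continuations of a
germ. -/
theorem exists_countable_representatives (a : Sphere) (φ : Sphere → ℂ) :
    ∃ E : Set (Sphere → ℂ), E.Countable ∧
      ∀ b ψ, Reaches a φ b ψ → ∃ χ ∈ E, ψ =ᶠ[𝓝 b] χ := by
  classical
  obtain ⟨S, hSc, hS, hSb⟩ := exists_countable_isPreconnected_basis
  obtain ⟨D, hDc, hD⟩ := TopologicalSpace.exists_countable_dense Sphere
  -- The functions extending the germ of `ψ` at `q` to all of `V`. The value 0 off `V` is a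
  -- normalisation that leaves at most one such function.
  let step : Set Sphere → Sphere → (Sphere → ℂ) → Set (Sphere → ℂ) := fun V q ψ =>
    {χ | (∀ x ∈ V, RegularAt χ x) ∧ (∀ x ∉ V, χ x = 0) ∧ q ∈ V ∧ χ =ᶠ[𝓝 q] ψ}
  have hstep : ∀ V ∈ S, ∀ q ψ, (step V q ψ).Countable := by
    intro V hV q ψ
    refine Set.Subsingleton.countable ?_
    rintro χ₁ ⟨hr₁, h0₁, hq, he₁⟩ χ₂ ⟨hr₂, h0₂, -, he₂⟩
    funext x
    by_cases hx : x ∈ V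
    · exact (eventuallyEq_of_isPreconnected (hS V hV).2 hr₁ hr₂ hq hx
        (he₁.trans he₂.symm)).eq_of_nhds
    · rw [h0₁ x hx, h0₂ x hx]
  let E : ℕ → Set (Sphere → ℂ) := fun n =>
    Nat.rec {φ} (fun _ X => ⋃ V ∈ S, ⋃ q ∈ D, ⋃ ψ ∈ X, step V q ψ) n
  have hE : ∀ n, (E n).Countable := by
    intro n
    induction n with
    | zero => exact countable_singleton φ
    | succ n ih =>
      exact hSc.biUnion fun V hV => hDc.biUnion fun q _ => ih.biUnion fun ψ _ => hstep V hV q ψ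
  refine ⟨⋃ n, E n, countable_iUnion hE, ?_⟩
  rintro b ψ ⟨γ, F, u, v, hγ, huv, rfl, rfl, hF, hφ, hψ⟩
  suffices h : ∃ χ ∈ ⋃ n, E n, F v =ᶠ[𝓝 (γ v)] χ by
    obtain ⟨χ, hχ, h⟩ := h
    exact ⟨χ, hχ, hψ.symm.trans h⟩
  refine (iff_of_isPreconnected (Q := fun t => ∃ χ ∈ ⋃ n, E n, F t =ᶠ[𝓝 (γ t)] χ)
    isPreconnected_Icc ?_ (left_mem_Icc.2 huv) (right_mem_Icc.2 huv)).1
    ⟨φ, mem_iUnion.2 ⟨0, rfl⟩, hφ⟩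
  intro t ht
  obtain ⟨V, hV, htV, hVr⟩ := hSb (γ t) _ (hF t ht).1.eventually
  have hVo := (hS V hV).1
  have hγV : ∀ᶠ s in 𝓝[Icc u v] t, γ s ∈ V :=
    nhdsWithin_le_nhds (hγ.continuousAt.eventually (hVo.mem_nhds htV))
  have hrep : ∀ x ∈ V, V.indicator (F t) =ᶠ[𝓝 x] F t := fun x hx =>
    Filter.eventuallyEq_of_mem (hVo.mem_nhds hx) fun y hy => indicator_of_mem hy _
  by_cases hQt : ∃ χ ∈ ⋃ n, E n, F t =ᶠ[𝓝 (γ t)] χ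
  · obtain ⟨χ, hχ, h⟩ := hQt
    filter_upwards [(hF t ht).2, nhdsWithin_le_nhds
      (hγ.continuousAt.eventually (eventually_eventually_nhds.2 h))] with s hs1 hs2
    exact ⟨fun _ => ⟨χ, hχ, hs1.trans hs2⟩, fun _ => ⟨χ, hχ, h⟩⟩
  -- If `F s` is represented, so is `F t`: both germs come from one function on `V`, and a point `q`
  -- of the dense set near `γ s` produces it in one more step.
  · filter_upwards [(hF t ht).2, hγV] with s hs1 hsV
    refine ⟨fun h => absurd h hQt, fun ⟨χ, hχ, hs2⟩ => absurd ?_ hQt⟩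
    obtain ⟨n, hn⟩ := mem_iUnion.1 hχ
    have h3 : V.indicator (F t) =ᶠ[𝓝 (γ s)] χ := (hrep _ hsV).trans (hs1.symm.trans hs2)
    obtain ⟨W, hW, hWo, hsW⟩ := eventually_nhds_iff.1
      ((eventually_eventually_nhds.2 h3).and (hVo.mem_nhds hsV))
    obtain ⟨q, hqD, hqW⟩ := hD.exists_mem_open hWo ⟨_, hsW⟩
    refine ⟨V.indicator (F t), mem_iUnion.2 ⟨n + 1, ?_⟩, (hrep _ htV).symm⟩
    refine mem_iUnion₂.2 ⟨V, hV, mem_iUnion₂.2 ⟨q, hqD, mem_iUnion₂.2 ⟨χ, hn, ?_, ?_, ?_, ?_⟩⟩⟩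
    · exact fun x hx => (hVr hx : RegularAt (F t) x).congr (hrep x hx).symm
    · exact fun x hx => indicator_of_notMem hx _
    · exact (hW q hqW).2
    · exact (hW q hqW).1

theorem countable_of_isolated {X : Type*} [TopologicalSpace X] [SecondCountableTopology X]
    {Y : Set X} (h : ∀ x ∈ Y, ∀ᶠ y in 𝓝[≠] x, y ∉ Y) : Y.Countable := by
  have : DiscreteTopology Y := by
    rw [discreteTopology_subtype_iff]
    intro x hx
    rw [← Filter.empty_mem_iff_bot, mem_inf_principal]
    filter_upwards [h x hx] with y hy hy'
    exact hy hy'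
  exact (countable_of_Lindelof_of_discrete (X := Y)).to_set

/-- Uniqueness of continuation run backwards from `b`, against the constant family. -/
theorem Reaches.not_eventuallyEq_const {a b : Sphere} {φ ψ : Sphere → ℂ} {k : ℂ}
    (h : Reaches a φ b ψ) (hφ : ¬ φ =ᶠ[𝓝 a] fun _ => k) : ¬ ψ =ᶠ[𝓝 b] fun _ => k := by
  obtain ⟨γ, F, u, v, hγ, huv, rfl, rfl, hF, h0, h1⟩ := h
  intro hk
  refine hφ (h0.symm.trans ?_)
  exact IsContinuationOn.eventuallyEq hγ hF (G := fun _ _ => k)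
    (isContinuationOn_const fun t _ => regularAt_const k _) isPreconnected_Icc
    (right_mem_Icc.2 huv) (left_mem_Icc.2 huv) (h1.trans hk)

/-- A nonconstant multivalued function takes each value at countably many points. -/
theorem countable_setOf_reaches_eq {a : Sphere} {φ : Sphere → ℂ} {k : ℂ}
    (hφ : ¬ φ =ᶠ[𝓝 a] fun _ => k) : {b | ∃ ψ, Reaches a φ b ψ ∧ ψ b = k}.Countable := by
  obtain ⟨E, hE, hEr⟩ := exists_countable_representatives a φ
  -- The isolated `k`-points of an arbitrary function are countable, so each representative can be
  -- treated as a whole, wherever it is regular.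
  have h1 : ∀ χ : Sphere → ℂ, {b | χ b = k ∧ ∀ᶠ x in 𝓝[≠] b, χ x ≠ k}.Countable := by
    refine fun χ => countable_of_isolated fun x hx => ?_
    filter_upwards [hx.2] with y hy hy'
    exact hy hy'.1
  refine (hE.biUnion fun χ _ => h1 χ).mono ?_
  rintro b ⟨ψ, hψ, hk⟩
  obtain ⟨χ, hχE, hχ⟩ := hEr b ψ hψ
  refine mem_iUnion₂.2 ⟨χ, hχE, hχ.eq_of_nhds ▸ hk, ?_⟩
  by_contra hfr
  rw [← Filter.not_frequently, not_not] at hfr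
  exact hψ.not_eventuallyEq_const hφ (hχ.trans
    ((hψ.regularAt.congr hχ).eventuallyEq_of_frequently (regularAt_const k b) hfr))

/-- The germs of a continuation are reached from the initial germ. -/
theorem IsContinuationOn.reaches {γ : ℝ → Sphere} (hγ : Continuous γ) {F : ℝ → Sphere → ℂ}
    {u v t : ℝ} (hF : IsContinuationOn γ F (Icc u v)) (ht : t ∈ Icc u v) {φ : Sphere → ℂ}
    (h0 : F u =ᶠ[𝓝 (γ u)] φ) : Reaches (γ u) φ (γ t) (F t) :=
  ⟨γ, F, u, t, hγ, ht.1, rfl, rfl, hF.mono (Icc_subset_Icc_right ht.2), h0, EventuallyEq.rfl⟩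

/-! ### Continuation by local extension -/

/-- A germ satisfying a condition that extends locally can be continued along the whole path. -/
theorem exists_isContinuationOn_of_local {γ : ℝ → Sphere} (hγ : Continuous γ) {u v : ℝ}
    (huv : u ≤ v) {χ : Sphere → ℂ} (hχ : RegularAt χ (γ u)) {P : ℝ → (Sphere → ℂ) → Prop}
    (h0 : u < v → ∀ᶠ r in 𝓝[>] u, P r χ)
    (hloc : ∀ t ∈ Ioc u v, ∃ J ∈ 𝓝 t, ∀ s ∈ J, s ∈ Ioc u v → ∀ Ψ, RegularAt Ψ (γ s) → P s Ψ →
      ∃ Ψ', Ψ' =ᶠ[𝓝 (γ s)] Ψ ∧ ∀ r ∈ J, r ∈ Ioc u v → RegularAt Ψ' (γ r) ∧ P r Ψ') :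
    ∃ F, F u =ᶠ[𝓝 (γ u)] χ ∧ IsContinuationOn γ F (Icc u v) := by
  rcases huv.eq_or_lt with rfl | huv
  · refine ⟨fun _ => χ, EventuallyEq.rfl, isContinuationOn_const fun t ht => ?_⟩
    obtain rfl : t = u := le_antisymm ht.2 ht.1
    exact hχ
  -- The local condition says nothing at time `u`, whose point may be forbidden; up to some `m > u`
  -- the germ `χ` itself serves.
  obtain ⟨m, hum, hmv, hm, hPm⟩ : ∃ m, u < m ∧ m ≤ v ∧ (∀ t ∈ Icc u m, RegularAt χ (γ t)) ∧
      P m χ := by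
    have h1 : ∀ᶠ t in 𝓝 u, RegularAt χ (γ t) := hγ.continuousAt.eventually hχ.eventually
    obtain ⟨r, hr, hr1⟩ := Metric.eventually_nhds_iff_ball.1 h1
    have h2 : ∀ᶠ m in 𝓝[>] u, m < min v (u + r) :=
      nhdsWithin_le_nhds (gt_mem_nhds (lt_min huv (by linarith)))
    obtain ⟨m, hm1, hm2, hm3⟩ := ((h0 huv).and (h2.and self_mem_nhdsWithin)).exists
    have hm3' : u < m := hm3
    refine ⟨m, hm3, (hm2.trans_le (min_le_left _ _)).le, fun t ht => hr1 t ?_, hm1⟩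
    have := hm2.trans_le (min_le_right _ _)
    rw [Metric.mem_ball, Real.dist_eq, abs_of_nonneg (by linarith [ht.1])]
    linarith [ht.2]
  have hloc' : ∀ t : Icc m v, ∃ J : Set ℝ, IsOpen J ∧ (t : ℝ) ∈ J ∧ ∀ s ∈ J, s ∈ Ioc u v →
      ∀ Ψ, RegularAt Ψ (γ s) → P s Ψ →
        ∃ Ψ', Ψ' =ᶠ[𝓝 (γ s)] Ψ ∧ ∀ r ∈ J, r ∈ Ioc u v → RegularAt Ψ' (γ r) ∧ P r Ψ' := by
    intro t
    obtain ⟨J, hJ, h⟩ := hloc t ⟨hum.trans_le t.2.1, t.2.2⟩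
    obtain ⟨J', hJ', hJo, htJ⟩ := mem_nhds_iff.1 hJ
    refine ⟨J', hJo, htJ, fun s hs hs' Ψ hΨ hP => ?_⟩
    obtain ⟨Ψ', he, hr⟩ := h s (hJ' hs) hs' Ψ hΨ hP
    exact ⟨Ψ', he, fun r hrJ => hr r (hJ' hrJ)⟩
  choose J hJo htJ hJ using hloc'
  obtain ⟨τ, hτ0, hτm, ⟨N, hN⟩, hτJ⟩ := exists_monotone_Icc_subset_open_cover_Icc hmv
    (c := fun t : Icc m v => ((↑) : Icc m v → ℝ) ⁻¹' J t)
    (fun t => (hJo t).preimage continuous_subtype_val)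
    (fun t _ => mem_iUnion.2 ⟨t, htJ t⟩)
  have hind : ∀ n, ∃ F, F u =ᶠ[𝓝 (γ u)] χ ∧ IsContinuationOn γ F (Icc u (τ n)) ∧
      P (τ n) (F (τ n)) := by
    intro n
    induction n with
    | zero =>
      rw [hτ0]
      exact ⟨fun _ => χ, EventuallyEq.rfl, isContinuationOn_const hm, hPm⟩
    | succ n ih =>
      obtain ⟨F, hF0, hF, hP⟩ := ih
      obtain ⟨i, hi⟩ := hτJ n
      have hn : (τ n : ℝ) ≤ τ (n + 1) := hτm n.le_succ
      have hun : u < τ n := hum.trans_le (τ n).2.1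
      have hsub : ∀ r ∈ Icc (τ n : ℝ) (τ (n + 1)), r ∈ J i := fun r hr =>
        hi (show (⟨r, (τ n).2.1.trans hr.1, hr.2.trans (τ (n + 1)).2.2⟩ : Icc m v) ∈
          Icc (τ n) (τ (n + 1)) from hr)
      have hsub' : ∀ r ∈ Icc (τ n : ℝ) (τ (n + 1)), r ∈ Ioc u v := fun r hr =>
        ⟨hun.trans_le hr.1, hr.2.trans (τ (n + 1)).2.2⟩
      obtain ⟨Ψ, hΨ, hΨJ⟩ := hJ i (τ n) (hsub _ (left_mem_Icc.2 hn)) ⟨hun, (τ n).2.2⟩ (F (τ n))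
        (hF _ (right_mem_Icc.2 hun.le)).1 hP
      have hglue := hF.glue hγ (G := fun _ => Ψ) (v := τ (n + 1))
        (isContinuationOn_const fun r hr => (hΨJ r (hsub r hr) (hsub' r hr)).1) hΨ.symm
      -- The subdivision is only monotone. On a degenerate piece the old family is kept, because the
      -- glued one takes its value from `F` at the junction.
      rcases hn.eq_or_lt with heq | hlt
      · rw [← heq]
        exact ⟨F, hF0, hF, hP⟩
      · refine ⟨_, by simpa [hun.le] using hF0, hglue, ?_⟩
        simpa [not_le.2 hlt] using (hΨJ _ (hsub _ (right_mem_Icc.2 hn)) (hsub' _ (right_mem_Icc.2 hn))).2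
  obtain ⟨F, hF0, hF, -⟩ := hind N
  rw [hN N le_rfl] at hF
  exact ⟨F, hF0, hF⟩

/-! ### Arithmetic operations -/

theorem IsContinuationOn.add {γ : ℝ → Sphere} {F G : ℝ → Sphere → ℂ} {T : Set ℝ}
    (hF : IsContinuationOn γ F T) (hG : IsContinuationOn γ G T) :
    IsContinuationOn γ (fun t x => F t x + G t x) T := fun t ht =>
  ⟨(hF t ht).1.add (hG t ht).1, by
    filter_upwards [(hF t ht).2, (hG t ht).2] with s h₁ h₂ using h₁.add h₂⟩

theorem IsContinuationOn.sub {γ : ℝ → Sphere} {F G : ℝ → Sphere → ℂ} {T : Set ℝ}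
    (hF : IsContinuationOn γ F T) (hG : IsContinuationOn γ G T) :
    IsContinuationOn γ (fun t x => F t x - G t x) T := fun t ht =>
  ⟨(hF t ht).1.sub (hG t ht).1, by
    filter_upwards [(hF t ht).2, (hG t ht).2] with s h₁ h₂ using h₁.sub h₂⟩

theorem IsContinuationOn.mul {γ : ℝ → Sphere} {F G : ℝ → Sphere → ℂ} {T : Set ℝ}
    (hF : IsContinuationOn γ F T) (hG : IsContinuationOn γ G T) :
    IsContinuationOn γ (fun t x => F t x * G t x) T := fun t ht =>
  ⟨(hF t ht).1.mul (hG t ht).1, by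
    filter_upwards [(hF t ht).2, (hG t ht).2] with s h₁ h₂ using h₁.mul h₂⟩

theorem isForbidden_const (k : ℂ) (a : Sphere) : IsForbidden ∅ a fun _ => k := fun _ _ _ _ _ _ _ =>
  ⟨fun _ _ => k, EventuallyEq.rfl, isContinuationOn_const fun _ _ => regularAt_const k _⟩

theorem IsForbidden.add {A : Set Sphere} {a : Sphere} {φ ψ : Sphere → ℂ} (hφ : IsForbidden A a φ)
    (hψ : IsForbidden A a ψ) : IsForbidden A a fun x => φ x + ψ x := by
  intro γ hγ u v huv ha hA
  obtain ⟨F, hF0, hF⟩ := hφ γ hγ u v huv ha hA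
  obtain ⟨G, hG0, hG⟩ := hψ γ hγ u v huv ha hA
  exact ⟨_, hF0.add hG0, hF.add hG⟩

theorem IsForbidden.sub {A : Set Sphere} {a : Sphere} {φ ψ : Sphere → ℂ} (hφ : IsForbidden A a φ)
    (hψ : IsForbidden A a ψ) : IsForbidden A a fun x => φ x - ψ x := by
  intro γ hγ u v huv ha hA
  obtain ⟨F, hF0, hF⟩ := hφ γ hγ u v huv ha hA
  obtain ⟨G, hG0, hG⟩ := hψ γ hγ u v huv ha hA
  exact ⟨_, hF0.sub hG0, hF.sub hG⟩

theorem IsForbidden.mul {A : Set Sphere} {a : Sphere} {φ ψ : Sphere → ℂ} (hφ : IsForbidden A a φ)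
    (hψ : IsForbidden A a ψ) : IsForbidden A a fun x => φ x * ψ x := by
  intro γ hγ u v huv ha hA
  obtain ⟨F, hF0, hF⟩ := hφ γ hγ u v huv ha hA
  obtain ⟨G, hG0, hG⟩ := hψ γ hγ u v huv ha hA
  exact ⟨_, hF0.mul hG0, hF.mul hG⟩

/-- A continuation over `(u, v]` that starts off as a regular germ at `γ u`. -/
theorem IsContinuationOn.exists_of_Ioc {γ : ℝ → Sphere} {H : ℝ → Sphere → ℂ} {u v : ℝ}
    (hH : IsContinuationOn γ H (Ioc u v)) {χ : Sphere → ℂ} (hχ : RegularAt χ (γ u))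
    (h0 : ∀ᶠ s in 𝓝 u, s ∈ Ioc u v → H s =ᶠ[𝓝 (γ s)] χ) :
    ∃ F, F u =ᶠ[𝓝 (γ u)] χ ∧ IsContinuationOn γ F (Icc u v) := by
  refine ⟨fun t => if u < t then H t else χ, by simp, fun t ht => ?_⟩
  rcases ht.1.eq_or_lt with rfl | hut
  · refine ⟨by simpa using hχ, ?_⟩
    filter_upwards [nhdsWithin_le_nhds h0, self_mem_nhdsWithin] with s hs hsT
    by_cases h : u < s
    · simpa [h] using hs ⟨h, hsT.2⟩
    · simp [h]
  · obtain ⟨h1, h2⟩ := hH t ⟨hut, ht.2⟩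
    refine ⟨by simpa [hut] using h1, ?_⟩
    rw [eventually_nhdsWithin_iff] at h2 ⊢
    filter_upwards [h2, lt_mem_nhds hut] with s hs hus hsT
    have hus' : u < s := hus
    simpa [hut, hus'] using hs ⟨hus, hsT.2⟩

theorem IsContinuationOn.eventually_start {γ : ℝ → Sphere} (hγ : Continuous γ)
    {F : ℝ → Sphere → ℂ} {u v : ℝ} (huv : u ≤ v) (hF : IsContinuationOn γ F (Icc u v))
    {φ : Sphere → ℂ} (h0 : F u =ᶠ[𝓝 (γ u)] φ) :
    ∀ᶠ s in 𝓝 u, s ∈ Ioc u v → F s =ᶠ[𝓝 (γ s)] φ := by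
  filter_upwards [eventually_nhdsWithin_iff.1 (hF u (left_mem_Icc.2 huv)).2,
    hγ.continuousAt.eventually (eventually_eventually_nhds.2 h0)] with s h1 h2 hs
  exact (h1 (Ioc_subset_Icc_self hs)).trans h2

/-- The quotient of the continued germs works as long as the denominator does not vanish. At the
start it may vanish with `χ` still regular, so `χ` is kept at time `u` and compared with the
quotient only afterwards. -/
theorem IsForbidden.div {A : Set Sphere} {a : Sphere} {φ ψ χ : Sphere → ℂ}
    (hφ : IsForbidden A a φ) (hψ : IsForbidden A a ψ) (hχ : RegularAt χ a)
    (h : ∀ᶠ x in 𝓝 a, χ x * ψ x = φ x) :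
    IsForbidden (A ∪ {b | ∃ Ψ, Reaches a ψ b Ψ ∧ Ψ b = 0}) a χ := by
  intro γ hγ u v huv ha hA
  obtain ⟨F, hF0, hF⟩ := hφ γ hγ u v huv ha fun t ht h => hA t ht (Or.inl h)
  obtain ⟨G, hG0, hG⟩ := hψ γ hγ u v huv ha fun t ht h => hA t ht (Or.inl h)
  subst ha
  have hG_ne : ∀ t ∈ Ioc u v, G t (γ t) ≠ 0 := fun t ht h0 =>
    hA t ht (Or.inr ⟨G t, hG.reaches hγ (Ioc_subset_Icc_self ht) hG0, h0⟩)
  refine IsContinuationOn.exists_of_Ioc (H := fun t x => F t x / G t x) (fun t ht => ?_) hχ ?_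
  · have hF1 := hF.mono Ioc_subset_Icc_self t ht
    have hG1 := hG.mono Ioc_subset_Icc_self t ht
    refine ⟨hF1.1.div hG1.1 (hG_ne t ht), ?_⟩
    filter_upwards [hF1.2, hG1.2] with s h₁ h₂ using h₁.div h₂
  · filter_upwards [hF.eventually_start hγ huv hF0, hG.eventually_start hγ huv hG0,
      hγ.continuousAt.eventually (eventually_eventually_nhds.2 h)] with s h₁ h₂ h₃ hs
    have h4 := ((hG s (Ioc_subset_Icc_self hs)).1.continuousAt).eventually_ne (hG_ne s hs)
    filter_upwards [h₁ hs, h₂ hs, h₃, h4] with x hx1 hx2 hx3 hx4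
    rw [hx1, ← hx3, ← hx2, mul_div_cancel_right₀ _ hx4]

/-! ### Composition -/

theorem IsContinuationOn.continuousOn_value {γ : ℝ → Sphere} (hγ : Continuous γ)
    {G : ℝ → Sphere → ℂ} {T : Set ℝ} (hG : IsContinuationOn γ G T) :
    ContinuousOn (fun t => G t (γ t)) T := by
  intro t ht
  have h1 : ContinuousWithinAt (fun s => G t (γ s)) T t :=
    ((hG t ht).1.continuousAt.comp hγ.continuousAt).continuousWithinAt
  refine h1.congr_of_eventuallyEq ?_ rfl
  filter_upwards [(hG t ht).2] with s hs using hs.eq_of_nhds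

theorem IsContinuationOn.comp_germ {γ δ : ℝ → Sphere} {F G : ℝ → Sphere → ℂ} {T : Set ℝ}
    (hG : IsContinuationOn γ G T) (hF : IsContinuationOn δ F T)
    (hδ : ∀ t ∈ T, δ t = (G t (γ t) : ℂ)) :
    IsContinuationOn γ (fun t x => F t ((G t x : ℂ) : Sphere)) T := by
  intro t ht
  refine ⟨RegularAt.comp (hδ t ht ▸ (hF t ht).1) (hG t ht).1, ?_⟩
  filter_upwards [(hF t ht).2, (hG t ht).2, self_mem_nhdsWithin] with s h₁ h₂ hs
  have hc : ContinuousAt (fun x => ((G s x : ℂ) : Sphere)) (γ s) :=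
    OnePoint.continuous_coe.continuousAt.comp (hG s hs).1.continuousAt
  rw [hδ s hs] at h₁
  filter_upwards [h₂, hc.eventually h₁] with x hx1 hx2
  rw [hx2, hx1]

/-- The values of the continued inner germ along `γ` form a path in the plane, and the outer germ is
continued along it; that path must not meet `B` after the start. -/
theorem IsForbidden.comp {A B : Set Sphere} {a : Sphere} {φ ψ : Sphere → ℂ}
    (hφ : IsForbidden B ((ψ a : ℂ) : Sphere) φ) (hψ : IsForbidden A a ψ) :
    IsForbidden (A ∪ {b | ∃ Ψ, Reaches a ψ b Ψ ∧ ((Ψ b : ℂ) : Sphere) ∈ B}) a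
      (fun x => φ ((ψ x : ℂ) : Sphere)) := by
  intro γ hγ u v huv ha hA
  obtain ⟨G, hG0, hG⟩ := hψ γ hγ u v huv ha fun t ht h => hA t ht (Or.inl h)
  subst ha
  have hcont : ContinuousOn (fun t => ((G t (γ t) : ℂ) : Sphere)) (Icc u v) :=
    OnePoint.continuous_coe.comp_continuousOn (hG.continuousOn_value hγ)
  let δ : ℝ → Sphere := IccExtend huv (domRestrict (Icc u v) fun t => ((G t (γ t) : ℂ) : Sphere))
  have hδ : Continuous δ := (continuousOn_iff_continuous_domRestrict.1 hcont).Icc_extend'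
  have hδG : ∀ t ∈ Icc u v, δ t = (G t (γ t) : ℂ) := fun t ht =>
    IccExtend_of_mem huv _ ht
  have hu : δ u = ((ψ (γ u) : ℂ) : Sphere) := by
    rw [hδG u (left_mem_Icc.2 huv), hG0.eq_of_nhds]
  obtain ⟨F, hF0, hF⟩ := hφ δ hδ u v huv hu fun t ht h => hA t ht (Or.inr
    ⟨G t, hG.reaches hγ (Ioc_subset_Icc_self ht) hG0, hδG t (Ioc_subset_Icc_self ht) ▸ h⟩)
  refine ⟨_, ?_, hG.comp_germ hF hδG⟩
  have hc : ContinuousAt (fun x => ((G u x : ℂ) : Sphere)) (γ u) :=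
    OnePoint.continuous_coe.continuousAt.comp (hG u (left_mem_Icc.2 huv)).1.continuousAt
  rw [← hG0.eq_of_nhds] at hF0
  filter_upwards [hG0, hc.eventually hF0] with x hx1 hx2
  rw [hx2, hx1]

/-! ### Differentiation and integration -/

/-- The finite coordinate of a point of the sphere. -/
noncomputable def finiteCoord (x : Sphere) : ℂ := OnePoint.elim x 0 id

@[simp]
theorem finiteCoord_coe (z : ℂ) : finiteCoord (z : Sphere) = z := rfl

theorem eventually_ne_infty {x : Sphere} (hx : x ≠ OnePoint.infty) :
    ∀ᶠ y in 𝓝 x, ∃ z : ℂ, y = (z : Sphere) := by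
  filter_upwards [isOpen_compl_singleton.mem_nhds hx] with y hy
  obtain ⟨z, hz⟩ := OnePoint.ne_infty_iff_exists.1 hy
  exact ⟨z, hz.symm⟩

/-- Forbidding `∞` costs one point and leaves only finite points to treat after the start, where the
derivative is taken in the finite coordinate. -/
theorem IsForbidden.deriv {A : Set Sphere} {a : Sphere} {φ χ : Sphere → ℂ}
    (hφ : IsForbidden A a φ) (hχ : RegularAt χ a) (h : IsDerivativeNear a φ χ) :
    IsForbidden (A ∪ {OnePoint.infty}) a χ := by
  intro γ hγ u v huv ha hA
  obtain ⟨F, hF0, hF⟩ := hφ γ hγ u v huv ha fun t ht h => hA t ht (Or.inl h)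
  have hfin : ∀ t ∈ Ioc u v, γ t ≠ OnePoint.infty := fun t ht h => hA t ht (Or.inr h)
  subst ha
  have hderiv : ∀ {Φ Ψ : Sphere → ℂ} {z : ℂ}, Φ =ᶠ[𝓝 (z : Sphere)] Ψ →
      _root_.deriv (fun w : ℂ => Φ w) z = _root_.deriv (fun w : ℂ => Ψ w) z := fun h =>
    EventuallyEq.deriv_eq (isChart_coe.eventually_iff.1 h)
  refine IsContinuationOn.exists_of_Ioc
    (H := fun t x => _root_.deriv (fun w : ℂ => F t w) (finiteCoord x)) (fun t ht => ?_) hχ ?_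
  · obtain ⟨h1, h2⟩ := hF.mono Ioc_subset_Icc_self t ht
    constructor
    · obtain ⟨z, hz⟩ := OnePoint.ne_infty_iff_exists.1 (hfin t ht)
      rw [← hz, regularAt_coe] at h1 ⊢
      exact h1.deriv
    · filter_upwards [h2, self_mem_nhdsWithin] with s hs hsT
      filter_upwards [eventually_ne_infty (hfin s hsT), eventually_eventually_nhds.2 hs] with x hx hx'
      obtain ⟨z, rfl⟩ := hx
      exact hderiv hx'
  · filter_upwards [hF.eventually_start hγ huv hF0,
      hγ.continuousAt.eventually (eventually_eventually_nhds.2 h)] with s h1 h2 hs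
    filter_upwards [eventually_ne_infty (hfin s hs), eventually_eventually_nhds.2 (h1 hs), h2]
      with x hx hx1 hx2
    obtain ⟨z, rfl⟩ := hx
    rw [finiteCoord_coe, hderiv hx1]
    exact (hx2 z rfl).deriv

theorem eventually_eq_const_of_hasDerivAt_zero {D : ℂ → ℂ} {z : ℂ}
    (h : ∀ᶠ w in 𝓝 z, HasDerivAt D 0 w) : ∃ k, ∀ᶠ w in 𝓝 z, D w = k := by
  obtain ⟨r, hr, hD⟩ := Metric.eventually_nhds_iff_ball.1 h
  obtain ⟨k, hk⟩ := Metric.isOpen_ball.exists_is_const_of_deriv_eq_zero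
    (convex_ball z r).isPreconnected
    (fun w hw => (hD w hw).differentiableAt.differentiableWithinAt) (fun w hw => (hD w hw).deriv)
  exact ⟨k, mem_of_superset (Metric.ball_mem_nhds z hr) hk⟩

/-- Integration of a family of germs along a path. -/
theorem exists_isContinuationOn_of_derivative {γ : ℝ → Sphere} (hγ : Continuous γ) {u v : ℝ}
    (huv : u ≤ v) {χ : Sphere → ℂ} (hχ : RegularAt χ (γ u)) {F : ℝ → Sphere → ℂ}
    (hF : IsContinuationOn γ F (Ioc u v)) (hfin : ∀ t ∈ Ioc u v, γ t ≠ OnePoint.infty)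
    (h : u < v → ∀ᶠ s in 𝓝[>] u, IsDerivativeNear (γ s) χ (F s)) :
    ∃ H, H u =ᶠ[𝓝 (γ u)] χ ∧ IsContinuationOn γ H (Icc u v) := by
  refine exists_isContinuationOn_of_local hγ huv hχ
    (P := fun s Ψ => IsDerivativeNear (γ s) Ψ (F s)) h fun t ht => ?_
  obtain ⟨z, hz⟩ := OnePoint.ne_infty_iff_exists.1 (hfin t ht)
  obtain ⟨h1, h2⟩ := hF t ht
  rw [← hz, regularAt_coe] at h1
  obtain ⟨r, hr, hr1⟩ := Metric.eventually_nhds_iff_ball.1 h1.eventually_analyticAt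
  -- On this disc `F t` has a primitive `p`. A germ with the right derivative at a point of the disc
  -- is `p` plus a constant, hence extends to the whole disc.
  obtain ⟨p, hp⟩ := DifferentiableOn.isExactOn_ball
    fun w hw => (hr1 w hw).differentiableAt.differentiableWithinAt
  have hpan : ∀ w ∈ Metric.ball z r, AnalyticAt ℂ p w := fun w hw =>
    DifferentiableOn.analyticAt (s := Metric.ball z r)
      (fun y hy => (hp y hy).differentiableAt.differentiableWithinAt)
      (Metric.isOpen_ball.mem_nhds hw)
  have hopen : IsOpen ((fun z : ℂ => (z : Sphere)) '' Metric.ball z r) :=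
    isChart_coe.isOpenEmbedding.isOpenMap _ Metric.isOpen_ball
  refine ⟨{s | γ s ∈ (fun z : ℂ => (z : Sphere)) '' Metric.ball z r ∧
    (s ∈ Ioc u v → F s =ᶠ[𝓝 (γ s)] F t)}, ?_, ?_⟩
  · refine Filter.inter_mem (hγ.continuousAt.eventually (hopen.mem_nhds ?_))
      (eventually_nhdsWithin_iff.1 h2)
    exact ⟨z, Metric.mem_ball_self hr, hz⟩
  · rintro s ⟨⟨y, hy, hys⟩, hsF⟩ hs Ψ hΨ hP
    simp only at hys
    have hsF := hsF hs
    simp only [← hys] at hsF hP ⊢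
    have hD : ∀ᶠ w in 𝓝 y, HasDerivAt (fun w : ℂ => Ψ w - p w) 0 w := by
      filter_upwards [isChart_coe.eventually_iff.1 hP, isChart_coe.eventually_iff.1 hsF,
        Metric.isOpen_ball.mem_nhds hy] with w hw1 hw2 hw3
      have := (hw1 w rfl).sub (hp w hw3)
      rwa [hw2, sub_self] at this
    obtain ⟨k, hk⟩ := eventually_eq_const_of_hasDerivAt_zero hD
    refine ⟨fun x => p (finiteCoord x) + k, ?_, ?_⟩
    · refine isChart_coe.eventually_iff.2 ?_
      filter_upwards [hk] with w hw
      rw [finiteCoord_coe, ← hw]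
      ring
    · rintro q ⟨⟨y', hy', hyq⟩, hqF⟩ hq
      have hqF := hqF hq
      simp only at hyq
      simp only [← hyq] at hqF ⊢
      refine ⟨regularAt_coe.2 ((hpan y' hy').add analyticAt_const), ?_⟩
      filter_upwards [hqF, hopen.mem_nhds ⟨y', hy', rfl⟩] with x hx1 hx2
      rintro w rfl
      obtain ⟨w', hw', hww'⟩ := hx2
      obtain rfl : w' = w := OnePoint.coe_injective hww'
      rw [hx1]
      exact (hp w' hw').add_const k

/-- Here `∞` is a genuine obstruction: `1 / x` is regular there, but its integral, the logarithm, is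
not. -/
theorem IsForbidden.integral {A : Set Sphere} {a : Sphere} {φ χ : Sphere → ℂ}
    (hφ : IsForbidden A a φ) (hχ : RegularAt χ a) (h : IsDerivativeNear a χ φ) :
    IsForbidden (A ∪ {OnePoint.infty}) a χ := by
  intro γ hγ u v huv ha hA
  obtain ⟨F, hF0, hF⟩ := hφ γ hγ u v huv ha fun t ht h => hA t ht (Or.inl h)
  have hfin : ∀ t ∈ Ioc u v, γ t ≠ OnePoint.infty := fun t ht h => hA t ht (Or.inr h)
  subst ha
  refine exists_isContinuationOn_of_derivative hγ huv hχ (hF.mono Ioc_subset_Icc_self) hfin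
    fun huv' => ?_
  filter_upwards [nhdsWithin_le_nhds (hF.eventually_start hγ huv hF0), Ioc_mem_nhdsGT huv',
    nhdsWithin_le_nhds (hγ.continuousAt.eventually (eventually_eventually_nhds.2 h))]
    with s h1 hs h2
  filter_upwards [h1 hs, h2] with x hx1 hx2 z hz
  rw [hx1]
  exact hx2 z hz

/-! ### Algebraic equations -/

open Polynomial in
/-- An integral element is a root of a polynomial coprime to its derivative up to a nonzero
constant. -/
theorem exists_coprime_derivative {R O : Type*} [CommRing R] [IsDomain R] [CharZero R] [CommRing O]
    [IsDomain O] [Algebra R O] [FaithfulSMul R O] {x : O} (hx : IsIntegral R x) :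
    ∃ (Q U V : R[X]) (r : R), r ≠ 0 ∧ Q ≠ 0 ∧ aeval x Q = 0 ∧ U * Q + V * derivative Q = C r := by
  let K := FractionRing R
  let L := FractionRing O
  have : FaithfulSMul R L := by
    rw [faithfulSMul_iff_algebraMap_injective, IsScalarTower.algebraMap_eq R O L]
    exact (IsFractionRing.injective O L).comp (FaithfulSMul.algebraMap_injective R O)
  let _ : Algebra K L := FractionRing.liftAlgebra R L
  have : IsScalarTower R K L := FractionRing.isScalarTower_liftAlgebra R L
  have hinj : Function.Injective (algebraMap R K) := IsFractionRing.injective R K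
  have : CharZero K := charZero_of_injective_algebraMap hinj
  let y : L := algebraMap O L x
  have hy : IsIntegral K y := (hx.map (IsScalarTower.toAlgHom R O L)).tower_top
  -- Over the fraction field the minimal polynomial is irreducible, hence separable in
  -- characteristic zero; the Bézout identity with its derivative is then cleared of denominators.
  have hirr : Irreducible (minpoly K y) := minpoly.irreducible hy
  obtain ⟨α, β, hαβ⟩ := hirr.separable
  have hclear : ∀ p : K[X], ∃ s : R, s ≠ 0 ∧ ∃ P : R[X],
      P.map (algebraMap R K) = C (algebraMap R K s) * p := by
    intro p
    obtain ⟨s, hs, hsp⟩ := IsLocalization.integerNormalization_spec (nonZeroDivisors R) p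
    refine ⟨s, nonZeroDivisors.ne_zero hs,
      IsLocalization.integerNormalization (nonZeroDivisors R) p, hsp.trans ?_⟩
    ext i
    rw [coeff_smul, coeff_C_mul, Algebra.smul_def]
  obtain ⟨s₁, hs₁, Q, hQ⟩ := hclear (minpoly K y)
  obtain ⟨s₂, hs₂, U, hU⟩ := hclear α
  obtain ⟨s₃, hs₃, V, hV⟩ := hclear β
  -- `Q`, `U`, `V` carry the factors `s₁`, `s₂`, `s₃`; the extra `s₃` and `s₂` give both Bézout
  -- terms the common factor `s₁ s₂ s₃`.
  refine ⟨Q, C s₃ * U, C s₂ * V, s₁ * s₂ * s₃, mul_ne_zero (mul_ne_zero hs₁ hs₂) hs₃, ?_, ?_, ?_⟩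
  · rintro rfl
    rw [Polynomial.map_zero] at hQ
    exact mul_ne_zero (C_ne_zero.2 ((map_ne_zero_iff _ hinj).2 hs₁)) hirr.ne_zero hQ.symm
  · apply IsFractionRing.injective O L
    rw [map_zero, ← aeval_algebraMap_apply, ← aeval_map_algebraMap K, hQ, map_mul, minpoly.aeval,
      mul_zero]
  · apply Polynomial.map_injective _ hinj
    simp only [Polynomial.map_add, Polynomial.map_mul, map_C, ← derivative_map, hQ, hU, hV, map_mul,
      derivative_mul, derivative_C, zero_mul, zero_add]
    linear_combination C (algebraMap R K s₁) * C (algebraMap R K s₂) * C (algebraMap R K s₃) * hαβ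

theorem isInvertible_of_apply_one_ne_zero {L : ℂ →L[ℂ] ℂ} (h : L 1 ≠ 0) : L.IsInvertible := by
  refine ⟨ContinuousLinearEquiv.unitsEquivAut ℂ (Units.mk0 _ h), ?_⟩
  ext
  simp

/-- Cauchy's bound: when `1 ≤ ‖y‖`, the top term is balanced by lower ones, each at most `‖q i‖ ‖y‖
^ (d - 1)`. It confines the roots to a compact disc in `exists_local_roots`. -/
theorem norm_mul_pow_le {d : ℕ} {q : ℕ → ℂ} {y : ℂ} (hy : 1 ≤ ‖y‖)
    (h : ∑ i ∈ Finset.range (d + 1), q i * y ^ i = 0) :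
    ‖q d‖ * ‖y‖ ≤ ∑ i ∈ Finset.range d, ‖q i‖ := by
  rw [Finset.sum_range_succ] at h
  have h1 : ‖q d‖ * ‖y‖ ^ d ≤ ∑ i ∈ Finset.range d, ‖q i‖ * ‖y‖ ^ i := by
    rw [← norm_pow, ← norm_mul, ← neg_eq_of_add_eq_zero_right h, norm_neg]
    refine (norm_sum_le _ _).trans (Finset.sum_le_sum fun i _ => ?_)
    rw [norm_mul, norm_pow]
  have hpos : 0 < ‖y‖ ^ d := by positivity
  refine le_of_mul_le_mul_right ?_ hpos
  calc ‖q d‖ * ‖y‖ * ‖y‖ ^ d = (‖q d‖ * ‖y‖ ^ d) * ‖y‖ := by ring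
    _ ≤ (∑ i ∈ Finset.range d, ‖q i‖ * ‖y‖ ^ i) * ‖y‖ := by gcongr
    _ = ∑ i ∈ Finset.range d, ‖q i‖ * ‖y‖ ^ (i + 1) := by
      rw [Finset.sum_mul]
      exact Finset.sum_congr rfl fun i _ => by ring
    _ ≤ ∑ i ∈ Finset.range d, ‖q i‖ * ‖y‖ ^ d := by
      refine Finset.sum_le_sum fun i hi => ?_
      gcongr
      exact Finset.mem_range.1 hi
    _ = (∑ i ∈ Finset.range d, ‖q i‖) * ‖y‖ ^ d := by rw [Finset.sum_mul]

open Polynomial in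
/-- Near a point where all roots are simple, the roots of a polynomial with analytic coefficients
are finitely many analytic functions. -/
theorem exists_local_roots {d : ℕ} {q : ℕ → ℂ → ℂ} {z : ℂ} (hq : ∀ i, AnalyticAt ℂ (q i) z)
    {p : ℂ[X]} (hp : p.natDegree ≤ d) (hpq : ∀ i, p.coeff i = q i z) (hd : q d z ≠ 0)
    (hsimple : ∀ y, p.eval y = 0 → (derivative p).eval y ≠ 0) :
    ∃ (S : Finset ℂ) (η : ℂ → ℂ → ℂ), (∀ y ∈ S, AnalyticAt ℂ (η y) z ∧
      ∀ᶠ w in 𝓝 z, ∑ i ∈ Finset.range (d + 1), q i w * η y w ^ i = 0) ∧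
      ∀ᶠ w in 𝓝 z, ∀ y', ∑ i ∈ Finset.range (d + 1), q i w * y' ^ i = 0 → ∃ y ∈ S, y' = η y w := by
  let f : ℂ × ℂ → ℂ := fun v => ∑ i ∈ Finset.range (d + 1), q i v.1 * v.2 ^ i
  have hfp : ∀ y, f (z, y) = p.eval y := fun y => by
    rw [eval_eq_sum_range' (Nat.lt_succ_of_le hp)]
    exact Finset.sum_congr rfl fun i _ => by rw [hpq]
  have hp0 : p ≠ 0 := by
    rintro rfl
    exact hd (by rw [← hpq, coeff_zero])
  have hfan : ∀ y, AnalyticAt ℂ f (z, y) := fun y =>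
    Finset.analyticAt_fun_sum _ fun i _ =>
      (AnalyticAt.comp_of_eq (hq i) analyticAt_fst rfl).mul (analyticAt_snd.pow i)
  have hinv : ∀ y, p.eval y = 0 →
      (fderiv ℂ f (z, y) ∘L .inr ℂ ℂ ℂ).IsInvertible := by
    intro y hy
    apply isInvertible_of_apply_one_ne_zero
    have h1 : HasDerivAt (fun y => f (z, y)) (fderiv ℂ f (z, y) ((0 : ℂ), (1 : ℂ))) y := by
      have := (hfan y).differentiableAt.hasFDerivAt.comp_hasDerivAt y
        ((hasDerivAt_const y z).prodMk (hasDerivAt_id y))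
      exact this
    have h2 : HasDerivAt (fun y => f (z, y)) ((derivative p).eval y) y := by
      simp only [hfp]
      exact p.hasDerivAt y
    have h3 := h1.unique h2
    simpa [h3] using hsimple y hy
  have hcd : ∀ y, ContDiffAt ℂ ⊤ f (z, y) := fun y => (hfan y).contDiffAt
  have hloc : ∀ y, ∃ η : ℂ → ℂ, p.eval y = 0 → AnalyticAt ℂ η z ∧ (∀ᶠ w in 𝓝 z, f (w, η w) = 0) ∧
      ∀ᶠ v in 𝓝 (z, y), f v = 0 → v.2 = η v.1 := by
    intro y
    by_cases hy : p.eval y = 0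
    · have h0 : f (z, y) = 0 := by rw [hfp, hy]
      refine ⟨(hcd y).implicitFunction (by simp) (hinv y hy), fun _ => ⟨?_, ?_, ?_⟩⟩
      · exact ((hcd y).contDiffAt_implicitFunction (by simp) (hinv y hy)).analyticAt
      · filter_upwards [(hcd y).eventually_apply_implicitFunction (by simp) (hinv y hy)] with w hw
        rw [hw, h0]
      · filter_upwards [(hcd y).eventually_apply_eq_iff_implicitFunction (by simp) (hinv y hy)]
          with w hw hw'
        exact (hw.1 (hw'.trans h0.symm)).symm
    · exact ⟨0, fun h => absurd h hy⟩
  choose η hη using hloc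
  refine ⟨p.roots.toFinset, η, fun y hy => ?_, ?_⟩
  · have hy' : p.eval y = 0 := by simpa [hp0] using hy
    exact ⟨(hη y hy').1, (hη y hy').2.1⟩
  -- As the leading coefficient does not vanish, no root escapes to infinity. Compactness of the
  -- disc reduces the claim to a neighbourhood of each `(z, y)`, where the zeros are absent or lie
  -- on the graph of `η y`.
  · obtain ⟨M, hM⟩ : ∃ M : ℝ, ∀ᶠ w in 𝓝 z, ∀ y', f (w, y') = 0 → ‖y'‖ ≤ M := by
      have hcont : ContinuousAt (fun w => (∑ i ∈ Finset.range d, ‖q i w‖) / ‖q d w‖) z :=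
        (tendsto_finsetSum _ fun i _ => (hq i).continuousAt.norm).div (hq d).continuousAt.norm
          (norm_ne_zero_iff.2 hd)
      refine ⟨max 1 ((∑ i ∈ Finset.range d, ‖q i z‖) / ‖q d z‖ + 1), ?_⟩
      filter_upwards [hcont.eventually (gt_mem_nhds (lt_add_one _)),
        (hq d).continuousAt.eventually_ne hd] with w hw1 hw2 y' hy'
      by_cases h1 : 1 ≤ ‖y'‖
      · refine le_max_of_le_right (le_trans ?_ hw1.le)
        rw [le_div_iff₀ (norm_pos_iff.2 hw2), mul_comm]
        exact norm_mul_pow_le (q := fun i => q i w) h1 hy'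
      · exact le_max_of_le_left (not_le.1 h1).le
    have hK : ∀ᶠ w in 𝓝 z, ∀ y' ∈ Metric.closedBall (0 : ℂ) M, f (w, y') = 0 →
        ∃ y ∈ p.roots.toFinset, y' = η y w := by
      refine (isCompact_closedBall (0 : ℂ) M).eventually_forall_of_forall_eventually
        fun y _ => ?_
      by_cases hy : p.eval y = 0
      · filter_upwards [(hη y hy).2.2] with v hv hv0
        exact ⟨y, by simpa [hp0] using hy, hv hv0⟩
      · filter_upwards [(hfan y).continuousAt.eventually_ne (by rwa [hfp])] with v hv hv0
        exact absurd hv0 hv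
    filter_upwards [hM, hK] with w hw1 hw2 y' hy'
    exact hw2 y' (by simpa using hw1 y' hy') hy'

/-- The ring of regular germs at `a`. -/
def regularGerms (a : Sphere) : Subring (Germ (𝓝 a) ℂ) where
  carrier := {g | ∃ φ : Sphere → ℂ, RegularAt φ a ∧ g = (φ : Germ (𝓝 a) ℂ)}
  mul_mem' := by
    rintro _ _ ⟨φ, hφ, rfl⟩ ⟨ψ, hψ, rfl⟩
    exact ⟨_, hφ.mul hψ, rfl⟩
  one_mem' := ⟨_, regularAt_const 1 a, rfl⟩
  add_mem' := by
    rintro _ _ ⟨φ, hφ, rfl⟩ ⟨ψ, hψ, rfl⟩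
    exact ⟨_, hφ.add hψ, rfl⟩
  zero_mem' := ⟨_, regularAt_const 0 a, rfl⟩
  neg_mem' := by
    rintro _ ⟨φ, hφ, rfl⟩
    refine ⟨_, (regularAt_const 0 a).sub hφ, ?_⟩
    simp only [zero_sub]
    rfl

instance (a : Sphere) : CharZero (Germ (𝓝 a) ℂ) :=
  charZero_of_inj_zero fun n hn => by
    have := congrArg (Germ.valueRingHom (x := a)) hn
    simpa using this

/-- If a product vanishes near `a`, one factor vanishes frequently at points other than `a`, so its
germ is zero by the identity theorem. This is what allows `exists_coprime_derivative` to be applied.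
-/
instance (a : Sphere) : IsDomain (regularGerms a) := by
  have : NoZeroDivisors (regularGerms a) := by
    constructor
    rintro ⟨_, φ, hφ, rfl⟩ ⟨_, ψ, hψ, rfl⟩ h
    have h' : ∀ᶠ x in 𝓝 a, φ x * ψ x = 0 := Germ.coe_eq.1 (congrArg Subtype.val h)
    have hz : ∀ {χ : Sphere → ℂ} (hχ : RegularAt χ a), (∃ᶠ x in 𝓝[≠] a, χ x = 0) →
        (⟨(χ : Germ (𝓝 a) ℂ), χ, hχ, rfl⟩ : regularGerms a) = 0 := fun hχ h =>
      Subtype.ext (Germ.coe_eq.2 (hχ.eventuallyEq_of_frequently (regularAt_const 0 a) h))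
    have hfr : ∃ᶠ x in 𝓝[≠] a, φ x = 0 ∨ ψ x = 0 := by
      refine Eventually.frequently ?_
      filter_upwards [mem_nhdsWithin_of_mem_nhds h'] with x hx
      exact mul_eq_zero.1 hx
    exact (frequently_or_distrib.1 hfr).imp (hz hφ) (hz hψ)
  exact NoZeroDivisors.to_isDomain _

/-- The ring of regular germs at `a` with forbidden set `A`. -/
def forbiddenGerms (A : Set Sphere) (a : Sphere) : Subring (regularGerms a) where
  carrier := {g | ∃ φ : Sphere → ℂ, IsForbidden A a φ ∧ (g : Germ (𝓝 a) ℂ) = φ}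
  mul_mem' := by
    rintro ⟨g, hg⟩ ⟨g', hg'⟩ ⟨φ, hφ, h⟩ ⟨ψ, hψ, h'⟩
    obtain rfl : g = φ := h
    obtain rfl : g' = ψ := h'
    exact ⟨_, hφ.mul hψ, rfl⟩
  one_mem' := ⟨_, (isForbidden_const 1 a).mono (empty_subset A), rfl⟩
  add_mem' := by
    rintro ⟨g, hg⟩ ⟨g', hg'⟩ ⟨φ, hφ, h⟩ ⟨ψ, hψ, h'⟩
    obtain rfl : g = φ := h
    obtain rfl : g' = ψ := h'
    exact ⟨_, hφ.add hψ, rfl⟩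
  zero_mem' := ⟨_, (isForbidden_const 0 a).mono (empty_subset A), rfl⟩
  neg_mem' := by
    rintro ⟨g, hg⟩ ⟨φ, hφ, h⟩
    obtain rfl : g = φ := h
    refine ⟨_, ((isForbidden_const 0 a).mono (empty_subset A)).sub hφ, ?_⟩
    simp only [zero_sub]
    rfl

open Polynomial in
/-- A regular germ that is integral over the germs with a countable forbidden set has a countable
forbidden set. -/
theorem exists_isForbidden_of_isIntegral {A : Set Sphere} (hA : A.Countable) {a : Sphere}
    {χ : Sphere → ℂ} (hχ : RegularAt χ a)
    (hχ_int : IsIntegral (forbiddenGerms A a) (⟨χ, χ, hχ, rfl⟩ : regularGerms a)) :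
    ∃ B : Set Sphere, B.Countable ∧ IsForbidden B a χ := by
  classical
  obtain ⟨Q, U, V, r, hr, hQ, hQχ, hUV⟩ := exists_coprime_derivative hχ_int
  have hrep : ∀ g : forbiddenGerms A a, ∃ φ : Sphere → ℂ, RegularAt φ a ∧ IsForbidden A a φ ∧
      ((g : regularGerms a) : Germ (𝓝 a) ℂ) = φ := by
    rintro ⟨⟨g, ψ, hψ, hgψ⟩, φ, hφ, h⟩
    obtain rfl : g = φ := h
    exact ⟨φ, hψ.congr (Germ.coe_eq.1 hgψ).symm, hφ, rfl⟩
  choose rep hrep_reg hrep_forb hrep_eq using hrep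
  have hrep0 : ∀ g : forbiddenGerms A a, g ≠ 0 → ¬ rep g =ᶠ[𝓝 a] fun _ => 0 := by
    intro g hg h
    refine hg (Subtype.ext (Subtype.ext ?_))
    rw [hrep_eq]
    exact Germ.coe_eq.2 h
  set d := Q.natDegree
  -- Besides `A`, one avoids the zeros of the continuations of `r`, where roots may collide, and of
  -- the leading coefficient, where a root may become infinite.
  refine ⟨A ∪ ({b | ∃ Ψ, Reaches a (rep r) b Ψ ∧ Ψ b = 0} ∪
    {b | ∃ Ψ, Reaches a (rep (Q.coeff d)) b Ψ ∧ Ψ b = 0}), hA.union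
    ((countable_setOf_reaches_eq (hrep0 r hr)).union
      (countable_setOf_reaches_eq (hrep0 _ (leadingCoeff_ne_zero.2 hQ)))), ?_⟩
  intro γ hγ u v huv ha hB
  subst ha
  have hcont := fun g => hrep_forb g γ hγ u v huv rfl fun t ht h => hB t ht (Or.inl h)
  choose F hF0 hF using hcont
  have huI := left_mem_Icc.2 huv
  -- evaluation of the continued germs along the path is a ring homomorphism
  have heq : ∀ {g : forbiddenGerms A (γ u)} {G : ℝ → Sphere → ℂ},
      IsContinuationOn γ G (Icc u v) → ((g : regularGerms (γ u)) : Germ (𝓝 (γ u)) ℂ) = G u →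
      ∀ t ∈ Icc u v, F g t (γ t) = G t (γ t) := fun {g G} hG h t ht =>
    (IsContinuationOn.eventuallyEq hγ (hF g) hG isPreconnected_Icc huI ht
      ((hF0 g).trans (Germ.coe_eq.1 ((hrep_eq g).symm.trans h)))).eq_of_nhds
  have hcoe : ∀ g : forbiddenGerms A (γ u),
      ((g : regularGerms (γ u)) : Germ (𝓝 (γ u)) ℂ) = F g u := fun g =>
    (hrep_eq g).trans (Germ.coe_eq.2 (hF0 g).symm)
  have hev : ∀ t ∈ Icc u v, ∃ e : forbiddenGerms A (γ u) →+* ℂ, ∀ g, e g = F g t (γ t) := by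
    intro t ht
    refine ⟨{ toFun := fun g => F g t (γ t), map_one' := ?_, map_mul' := fun g g' => ?_,
              map_zero' := ?_, map_add' := fun g g' => ?_ }, fun _ => rfl⟩
    · exact heq (G := fun _ _ => 1) (isContinuationOn_const fun _ _ => regularAt_const 1 _) rfl t ht
    · refine heq ((hF g).mul (hF g')) ?_ t ht
      change (g : Germ (𝓝 (γ u)) ℂ) * (g' : Germ (𝓝 (γ u)) ℂ) = _
      rw [hcoe, hcoe]
      rfl
    · exact heq (G := fun _ _ => 0) (isContinuationOn_const fun _ _ => regularAt_const 0 _) rfl t ht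
    · refine heq ((hF g).add (hF g')) ?_ t ht
      change (g : Germ (𝓝 (γ u)) ℂ) + (g' : Germ (𝓝 (γ u)) ℂ) = _
      rw [hcoe, hcoe]
      rfl
  have hstart : ∀ᶠ x in 𝓝 (γ u),
      ∑ i ∈ Finset.range (d + 1), F (Q.coeff i) u x * χ x ^ i = 0 := by
    have h1 : ((aeval (⟨χ, χ, hχ, rfl⟩ : regularGerms (γ u)) Q : regularGerms (γ u)) :
        Germ (𝓝 (γ u)) ℂ) = 0 := by rw [hQχ]; rfl
    rw [aeval_eq_sum_range, AddSubmonoidClass.coe_finsetSum] at h1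
    have h2 : ∀ i, ((Q.coeff i • (⟨χ, χ, hχ, rfl⟩ : regularGerms (γ u)) ^ i : regularGerms (γ u)) :
        Germ (𝓝 (γ u)) ℂ) = ((fun x => F (Q.coeff i) u x * χ x ^ i : Sphere → ℂ) :
          Germ (𝓝 (γ u)) ℂ) := by
      intro i
      change (Q.coeff i : Germ (𝓝 (γ u)) ℂ) * (χ : Germ (𝓝 (γ u)) ℂ) ^ i = _
      rw [hcoe]
      rfl
    simp only [h2] at h1
    have h3 : (∑ i ∈ Finset.range (d + 1), ((fun x => F (Q.coeff i) u x * χ x ^ i : Sphere → ℂ) :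
        Germ (𝓝 (γ u)) ℂ)) = ((∑ i ∈ Finset.range (d + 1),
          (fun x => F (Q.coeff i) u x * χ x ^ i : Sphere → ℂ) : Sphere → ℂ) :
            Germ (𝓝 (γ u)) ℂ) := (map_sum (Germ.coeRingHom (𝓝 (γ u))) _ _).symm
    filter_upwards [Germ.coe_eq.1 (h3.symm.trans h1)] with x hx
    simpa using hx
  refine exists_isContinuationOn_of_local hγ huv hχ (P := fun s Ψ => ∀ᶠ x in 𝓝 (γ s),
    ∑ i ∈ Finset.range (d + 1), F (Q.coeff i) s x * Ψ x ^ i = 0) (fun huv' => ?_) fun t ht => ?_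
  · have h1 : ∀ᶠ s in 𝓝 u, ∀ i ∈ Finset.range (d + 1), s ∈ Ioc u v →
        F (Q.coeff i) s =ᶠ[𝓝 (γ s)] F (Q.coeff i) u :=
      (Finset.eventually_all _).2 fun i _ => (hF (Q.coeff i)).eventually_start hγ huv
        EventuallyEq.rfl
    filter_upwards [nhdsWithin_le_nhds h1, Ioc_mem_nhdsGT huv', nhdsWithin_le_nhds
      (hγ.continuousAt.eventually (eventually_eventually_nhds.2 hstart))] with s hs1 hs2 hs3
    have h4 : ∀ᶠ x in 𝓝 (γ s), ∀ i ∈ Finset.range (d + 1),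
        F (Q.coeff i) s x = F (Q.coeff i) u x :=
      (Finset.eventually_all _).2 fun i hi => hs1 i hi hs2
    filter_upwards [hs3, h4] with x hx1 hx2
    rw [← hx1]
    exact Finset.sum_congr rfl fun i hi => by rw [hx2 i hi]
  · have htI := Ioc_subset_Icc_self ht
    obtain ⟨e, he⟩ := hev t htI
    obtain ⟨c, hc, z, hz⟩ := exists_isChart (γ t)
    have hlead : e (Q.coeff d) ≠ 0 := fun h0 => hB t ht (Or.inr (Or.inr
      ⟨_, (hF _).reaches hγ htI (hF0 _), by rw [← he]; exact h0⟩))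
    have hr0 : e r ≠ 0 := fun h0 => hB t ht (Or.inr (Or.inl
      ⟨_, (hF _).reaches hγ htI (hF0 _), by rw [← he]; exact h0⟩))
    obtain ⟨S, η, hη, hS⟩ := exists_local_roots (d := d) (z := z)
      (q := fun i w => F (Q.coeff i) t (c w)) (p := Q.map e)
      (fun i => (hc.regularAt_iff _ z).1 (hz ▸ (hF (Q.coeff i) t htI).1)) natDegree_map_le
      (fun i => by rw [coeff_map, he, hz]) (by rw [hz, ← he]; exact hlead) (by
        -- A common root of the specialised `Q` and its derivative would annihilate the left side of
        -- the Bézout identity, leaving `e r = 0`.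
        intro y hy hy'
        have h1 := congrArg (fun P => (P.map e).eval y) hUV
        simp only [Polynomial.map_add, Polynomial.map_mul, eval_add, eval_mul, map_C, eval_C,
          ← derivative_map, hy, hy', mul_zero, add_zero] at h1
        exact hr0 h1.symm)
    have hη' : ∀ᶠ w in 𝓝 z, ∀ y ∈ S, AnalyticAt ℂ (η y) w ∧
        ∑ i ∈ Finset.range (d + 1), F (Q.coeff i) t (c w) * η y w ^ i = 0 :=
      (Finset.eventually_all _).2 fun y hy =>
        (hη y hy).1.eventually_analyticAt.and (hη y hy).2
    obtain ⟨ρ, hρ, hball⟩ := Metric.eventually_nhds_iff_ball.1 (hη'.and hS)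
    have hopen : IsOpen (c '' Metric.ball z ρ) :=
      hc.isOpenEmbedding.isOpenMap _ Metric.isOpen_ball
    refine ⟨{s | γ s ∈ c '' Metric.ball z ρ ∧ (s ∈ Icc u v → ∀ i ∈ Finset.range (d + 1),
      F (Q.coeff i) s =ᶠ[𝓝 (γ s)] F (Q.coeff i) t)}, ?_, ?_⟩
    · refine Filter.inter_mem (hγ.continuousAt.eventually (hopen.mem_nhds
        ⟨z, Metric.mem_ball_self hρ, hz⟩)) ?_
      exact eventually_nhdsWithin_iff.1 ((Finset.eventually_all _).2 fun i _ =>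
        (hF (Q.coeff i) t htI).2)
    · rintro s ⟨⟨w₀, hw₀, hws⟩, hsF⟩ hs Ψ hΨ hP
      have hsF := hsF (Ioc_subset_Icc_self hs)
      simp only [← hws] at hsF hP hΨ ⊢
      have hroot : ∀ᶠ w in 𝓝 w₀, ∃ y ∈ S, Ψ (c w) = η y w := by
        have h4 : ∀ᶠ x in 𝓝 (c w₀), ∀ i ∈ Finset.range (d + 1),
            F (Q.coeff i) s x = F (Q.coeff i) t x :=
          (Finset.eventually_all _).2 fun i hi => hsF i hi
        filter_upwards [hc.eventually_iff.1 hP, hc.eventually_iff.1 h4,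
          Metric.isOpen_ball.mem_nhds hw₀] with w hw1 hw2 hw3
        refine (hball w hw3).2 _ ?_
        rw [← hw1]
        exact Finset.sum_congr rfl fun i hi => by rw [hw2 i hi]
      -- There are finitely many candidates, so one of them agrees with `Ψ` at points accumulating
      -- at `w₀`, hence near `w₀` by the identity theorem.
      obtain ⟨y, hyS, hy⟩ : ∃ y ∈ S, ∃ᶠ w in 𝓝[≠] w₀, Ψ (c w) = η y w := by
        by_contra hcon
        push Not at hcon
        have h5 : ∀ᶠ w in 𝓝[≠] w₀, ∀ y ∈ S, Ψ (c w) ≠ η y w :=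
          (Finset.eventually_all _).2 hcon
        obtain ⟨w, hw1, y, hy, hw2⟩ := (h5.and (nhdsWithin_le_nhds hroot)).exists
        exact hw1 y hy hw2
      have hΨη := (((hc.regularAt_iff _ _).1 hΨ).frequently_eq_iff_eventually_eq
        ((hball w₀ hw₀).1 y hyS).1).1 hy
      have hinv : ∀ w, Function.invFun c (c w) = w :=
        Function.leftInverse_invFun hc.isOpenEmbedding.injective
      refine ⟨fun x => η y (Function.invFun c x), ?_, ?_⟩
      · refine hc.eventually_iff.2 ?_
        filter_upwards [hΨη] with w hw
        rw [hinv, hw]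
      · rintro q ⟨⟨w₁, hw₁, hwq⟩, hqF⟩ hq
        have hqF := hqF (Ioc_subset_Icc_self hq)
        simp only [← hwq] at hqF ⊢
        refine ⟨(hc.regularAt_iff _ _).2 (by simpa only [hinv] using ((hball w₁ hw₁).1 y hyS).1), ?_⟩
        have h4 : ∀ᶠ x in 𝓝 (c w₁), ∀ i ∈ Finset.range (d + 1),
            F (Q.coeff i) q x = F (Q.coeff i) t x :=
          (Finset.eventually_all _).2 fun i hi => hqF i hi
        refine hc.eventually_iff.2 ?_
        filter_upwards [hc.eventually_iff.1 h4, Metric.isOpen_ball.mem_nhds hw₁] with w hw1 hw2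
        rw [← ((hball w hw2).1 y hyS).2]
        exact Finset.sum_congr rfl fun i hi => by rw [hw1 i hi, hinv]

open Polynomial in
/-- A regular germ satisfying a monic algebraic equation whose coefficients have a countable
forbidden set. -/
theorem exists_isForbidden_of_algebraic {A : Set Sphere} (hA : A.Countable) {a : Sphere} {n : ℕ}
    {φ : Fin n → Sphere → ℂ} (hreg : ∀ i, RegularAt (φ i) a) (hφ : ∀ i, IsForbidden A a (φ i))
    {χ : Sphere → ℂ} (hχ : RegularAt χ a)
    (h : ∀ᶠ x in 𝓝 a, χ x ^ n + ∑ i : Fin n, φ i x * χ x ^ (n - 1 - (i : ℕ)) = 0) :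
    ∃ B : Set Sphere, B.Countable ∧ IsForbidden B a χ := by
  refine exists_isForbidden_of_isIntegral hA hχ ?_
  let g : Fin n → forbiddenGerms A a := fun i => ⟨⟨φ i, φ i, hreg i, rfl⟩, φ i, hφ i, rfl⟩
  refine ⟨X ^ n + ∑ i : Fin n, C (g i) * X ^ (n - 1 - (i : ℕ)), monic_X_pow_add ?_, ?_⟩
  · refine (degree_sum_le _ _).trans_lt ((Finset.sup_lt_iff (WithBot.bot_lt_coe n)).2 fun i _ => ?_)
    refine (degree_C_mul_X_pow_le _ _).trans_lt ?_
    have := i.2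
    exact Nat.cast_lt.2 (by omega)
  · apply Subtype.ext
    simp only [eval₂_add, eval₂_X_pow, eval₂_finsetSum, eval₂_mul, eval₂_C]
    have h2 : ∀ i : Fin n, ((algebraMap (forbiddenGerms A a) (regularGerms a) (g i) *
        (⟨χ, χ, hχ, rfl⟩ : regularGerms a) ^ (n - 1 - (i : ℕ)) : regularGerms a) : Germ (𝓝 a) ℂ) =
          Germ.coeRingHom (𝓝 a) (fun x => φ i x * χ x ^ (n - 1 - (i : ℕ)) : Sphere → ℂ) :=
      fun _ => rfl
    have h3 : (((⟨χ, χ, hχ, rfl⟩ : regularGerms a) ^ n : regularGerms a) : Germ (𝓝 a) ℂ) =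
        Germ.coeRingHom (𝓝 a) (fun x => χ x ^ n : Sphere → ℂ) := rfl
    rw [Subring.coe_add, AddSubmonoidClass.coe_finsetSum, h3]
    simp only [h2]
    rw [← map_sum, ← map_add]
    refine Germ.coe_eq.2 ?_
    filter_upwards [h] with x hx
    simpa using hx

/-! ### Basic functions -/

/-- After the start `u` itself is the continuation. The base point may be `∞` or lie in `B`, where
only `φ` is known to be regular. -/
theorem isForbidden_of_function {u : ℂ → ℂ} {B : Set ℂ} (hu : ∀ z ∉ B, AnalyticAt ℂ u z)
    {a : Sphere} {φ : Sphere → ℂ} (hφ : RegularAt φ a)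
    (h : ∀ᶠ x in 𝓝 a, ∀ z : ℂ, x = (z : Sphere) → φ x = u z) :
    IsForbidden ((fun z : ℂ => (z : Sphere)) '' B ∪ {OnePoint.infty}) a φ := by
  intro γ hγ t₀ t₁ _ ha hA
  subst ha
  have hfin : ∀ t ∈ Ioc t₀ t₁, γ t ≠ OnePoint.infty := fun t ht h => hA t ht (Or.inr h)
  refine IsContinuationOn.exists_of_Ioc (H := fun _ x => u (finiteCoord x))
    (isContinuationOn_const fun t ht => ?_) hφ ?_
  · obtain ⟨z, hz⟩ := OnePoint.ne_infty_iff_exists.1 (hfin t ht)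
    rw [← hz, regularAt_coe]
    exact hu z fun hzB => hA t ht (Or.inl ⟨z, hzB, hz⟩)
  · filter_upwards [hγ.continuousAt.eventually (eventually_eventually_nhds.2 h)] with s hs1 hs
    filter_upwards [hs1, eventually_ne_infty (hfin s hs)] with x hx1 hx2
    obtain ⟨z, rfl⟩ := hx2
    exact (hx1 z rfl).symm

/-- Integrates a single-valued derivative, as needed for the logarithm, arctangent and arccotangent.
Since `B` is closed, the derivative is `u` on a whole neighbourhood of each later point near the
start. -/
theorem isForbidden_of_derivative {u : ℂ → ℂ} {B : Set ℂ} (hB : IsClosed B)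
    (hu : ∀ z ∉ B, AnalyticAt ℂ u z) {a : Sphere} {χ : Sphere → ℂ} (hχ : RegularAt χ a)
    (h : ∀ᶠ x in 𝓝 a, ∀ z : ℂ, x = (z : Sphere) → z ∉ B →
      HasDerivAt (fun w : ℂ => χ (w : Sphere)) (u z) z) :
    IsForbidden ((fun z : ℂ => (z : Sphere)) '' B ∪ {OnePoint.infty}) a χ := by
  intro γ hγ t₀ t₁ ht₀₁ ha hA
  subst ha
  have hcoord : ∀ t ∈ Ioc t₀ t₁, ∃ z : ℂ, z ∉ B ∧ (z : Sphere) = γ t := fun t ht => by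
    obtain ⟨z, hz⟩ := OnePoint.ne_infty_iff_exists.1 fun h => hA t ht (Or.inr h)
    exact ⟨z, fun hzB => hA t ht (Or.inl ⟨z, hzB, hz⟩), hz⟩
  refine exists_isContinuationOn_of_derivative hγ ht₀₁ hχ
    (F := fun _ x => u (finiteCoord x)) (isContinuationOn_const fun t ht => ?_)
    (fun t ht h => hA t ht (Or.inr h)) fun hlt => ?_
  · obtain ⟨z, hzB, hz⟩ := hcoord t ht
    rw [← hz, regularAt_coe]
    exact hu z hzB
  · filter_upwards [nhdsWithin_le_nhds
      (hγ.continuousAt.eventually (eventually_eventually_nhds.2 h)), Ioc_mem_nhdsGT hlt] with s hs1 hs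
    obtain ⟨z, hzB, hz⟩ := hcoord s hs
    rw [← hz] at hs1 ⊢
    have hB' : ∀ᶠ x in 𝓝 (z : Sphere), finiteCoord x ∉ B :=
      isChart_coe.eventually_iff.2 (hB.isOpen_compl.mem_nhds hzB)
    filter_upwards [hs1, hB'] with x hx1 hx2
    rintro w rfl
    exact hx1 w rfl hx2

/-- The derivative of a germ inverse to `u`. -/
theorem eventually_hasDerivAt_inverse {u : ℂ → ℂ} {a : Sphere} {φ : Sphere → ℂ}
    (hφ : RegularAt φ a) (h : ∀ᶠ x in 𝓝 a, ∀ z : ℂ, x = (z : Sphere) → u (φ x) = z) :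
    ∀ᶠ x in 𝓝 a, ∀ z : ℂ, x = (z : Sphere) → u (φ x) = z ∧
      ∀ u', HasDerivAt u u' (φ x) → u' * deriv (fun w : ℂ => φ w) z = 1 ∧
        HasDerivAt (fun w : ℂ => φ w) u'⁻¹ z := by
  filter_upwards [eventually_eventually_nhds.2 h, hφ.eventually] with x hx1 hx2
  rintro z rfl
  refine ⟨hx1.self_of_nhds z rfl, fun u' hu' => ?_⟩
  have h1 := (regularAt_coe.1 hx2).differentiableAt.hasDerivAt
  have h2 : HasDerivAt (fun w : ℂ => u (φ w)) (u' * deriv (fun w : ℂ => φ w) z) z :=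
    hu'.comp z h1
  have h3 : HasDerivAt (fun w : ℂ => u (φ w)) 1 z := by
    refine (hasDerivAt_id z).congr_of_eventuallyEq ?_
    filter_upwards [isChart_coe.eventually_iff.1 hx1] with w hw
    exact hw w rfl
  have h4 := h2.unique h3
  refine ⟨h4, ?_⟩
  rwa [eq_inv_of_mul_eq_one_right h4] at h1

/-- Near `∞` the values of a regular germ stay close to a finite one, so `u ∘ φ` is bounded there,
whereas the coordinate it should equal is not. -/
theorem ne_infty_of_inverse {u : ℂ → ℂ} (hu : Continuous u) {a : Sphere} {φ : Sphere → ℂ}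
    (hφ : RegularAt φ a) (h : ∀ᶠ x in 𝓝 a, ∀ z : ℂ, x = (z : Sphere) → u (φ x) = z) :
    a ≠ OnePoint.infty := by
  rintro rfl
  rw [← chartInfty_zero] at h hφ
  have h1 := isChart_chartInfty.eventually_iff.1 h
  have h2 : ContinuousAt (fun w : ℂ => w * u (φ (chartInfty w))) 0 :=
    continuousAt_id.mul (hu.continuousAt.comp
      (hφ.continuousAt.comp continuous_chartInfty.continuousAt))
  have h3 : Tendsto (fun w : ℂ => w * u (φ (chartInfty w))) (𝓝[≠] 0) (𝓝 0) := by
    simpa using h2.tendsto.mono_left nhdsWithin_le_nhds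
  have h4 : Tendsto (fun w : ℂ => w * u (φ (chartInfty w))) (𝓝[≠] 0) (𝓝 1) := by
    refine tendsto_const_nhds.congr' ?_
    filter_upwards [nhdsWithin_le_nhds h1, self_mem_nhdsWithin] with w hw1 hw2
    rw [hw1 w⁻¹ (chartInfty_of_ne_zero hw2), mul_inv_cancel₀ hw2]
  exact zero_ne_one (tendsto_nhds_unique h3 h4)

theorem exists_isForbidden_log {a : Sphere} {φ : Sphere → ℂ} (hφ : RegularAt φ a)
    (h : ∀ᶠ x in 𝓝 a, ∀ z : ℂ, x = (z : Sphere) → Complex.exp (φ x) = z) :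
    ∃ A : Set Sphere, A.Countable ∧ IsForbidden A a φ := by
  refine ⟨_, ((countable_singleton (0 : ℂ)).image _).union (countable_singleton _),
    isForbidden_of_derivative (u := fun z => z⁻¹) isClosed_singleton
      (fun z hz => analyticAt_inv hz) hφ ?_⟩
  filter_upwards [eventually_hasDerivAt_inverse hφ h] with x hx z hz _
  obtain ⟨h1, h2⟩ := hx z hz
  have h3 := (h2 _ (Complex.hasDerivAt_exp _)).2
  rwa [h1] at h3

theorem one_add_sq_ne_zero {z : ℂ} (hz : z ∉ ({0, Complex.I, -Complex.I} : Set ℂ)) :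
    1 + z ^ 2 ≠ 0 := by
  intro h
  have h1 : (z - Complex.I) * (z + Complex.I) = 0 := by
    linear_combination h - Complex.I_sq
  rcases mul_eq_zero.1 h1 with h2 | h2
  · exact hz (Or.inr (Or.inl (sub_eq_zero.1 h2)))
  · exact hz (Or.inr (Or.inr (eq_neg_of_add_eq_zero_left h2)))

/-- Inverse functions whose derivative is `κ / (1 + z ^ 2)`. -/
theorem exists_isForbidden_of_inverse_derivative {u : ℂ → ℂ} (κ : ℂ)
    (hu : ∀ y, u y ≠ 0 → ∃ u', HasDerivAt u u' y ∧ u'⁻¹ = κ / (1 + u y ^ 2)) {a : Sphere}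
    {φ : Sphere → ℂ} (hφ : RegularAt φ a)
    (h : ∀ᶠ x in 𝓝 a, ∀ z : ℂ, x = (z : Sphere) → u (φ x) = z) :
    ∃ A : Set Sphere, A.Countable ∧ IsForbidden A a φ := by
  -- 0 is excluded along with the poles `±i` of the derivative: `Complex.tan` and `Complex.cot` take
  -- the value 0 at their own poles, so only a nonzero value guarantees differentiability of `u` at
  -- `φ x`.
  have hfin : ({0, Complex.I, -Complex.I} : Set ℂ).Finite := by simp
  refine ⟨_, (hfin.countable.image _).union (countable_singleton _),
    isForbidden_of_derivative (u := fun z => κ / (1 + z ^ 2)) hfin.isClosed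
      (fun z hz => analyticAt_const.fun_div (analyticAt_const.add (analyticAt_id.pow 2))
        (one_add_sq_ne_zero hz)) hφ ?_⟩
  filter_upwards [eventually_hasDerivAt_inverse hφ h] with x hx z hz hzB
  obtain ⟨h1, h2⟩ := hx z hz
  obtain ⟨u', hu', he⟩ := hu (φ x) (by rw [h1]; exact fun h0 => hzB (Or.inl h0))
  have h3 := (h2 _ hu').2
  rwa [he, h1] at h3

theorem exists_isForbidden_arctan {a : Sphere} {φ : Sphere → ℂ} (hφ : RegularAt φ a)
    (h : ∀ᶠ x in 𝓝 a, ∀ z : ℂ, x = (z : Sphere) → Complex.tan (φ x) = z) :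
    ∃ A : Set Sphere, A.Countable ∧ IsForbidden A a φ := by
  refine exists_isForbidden_of_inverse_derivative 1 (fun y hy => ?_) hφ h
  have hc : Complex.cos y ≠ 0 := fun h0 => hy (by rw [Complex.tan_eq_sin_div_cos, h0, div_zero])
  refine ⟨_, Complex.hasDerivAt_tan hc, ?_⟩
  have h1 : 1 + Complex.tan y ^ 2 = 1 / Complex.cos y ^ 2 := by
    rw [Complex.tan_eq_sin_div_cos, div_pow, eq_div_iff (pow_ne_zero 2 hc), add_mul,
      div_mul_cancel₀ _ (pow_ne_zero 2 hc), one_mul, Complex.cos_sq_add_sin_sq]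
  rw [h1]
  simp

theorem exists_isForbidden_arccot {a : Sphere} {φ : Sphere → ℂ} (hφ : RegularAt φ a)
    (h : ∀ᶠ x in 𝓝 a, ∀ z : ℂ, x = (z : Sphere) → Complex.cot (φ x) = z) :
    ∃ A : Set Sphere, A.Countable ∧ IsForbidden A a φ := by
  refine exists_isForbidden_of_inverse_derivative (-1) (fun y hy => ?_) hφ h
  have hs : Complex.sin y ≠ 0 := fun h0 => hy (by rw [Complex.cot_eq_cos_div_sin, h0, div_zero])
  refine ⟨-1 / Complex.sin y ^ 2, ?_, ?_⟩
  · have h1 := (Complex.hasDerivAt_cos y).div (Complex.hasDerivAt_sin y) hs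
    have h2 : -Complex.sin y * Complex.sin y - Complex.cos y * Complex.cos y = -1 := by
      linear_combination -Complex.sin_sq_add_cos_sq y
    rw [h2] at h1
    exact h1
  · have h1 : 1 + Complex.cot y ^ 2 = 1 / Complex.sin y ^ 2 := by
      rw [Complex.cot_eq_cos_div_sin, div_pow, eq_div_iff (pow_ne_zero 2 hs), add_mul,
        div_mul_cancel₀ _ (pow_ne_zero 2 hs), one_mul, Complex.sin_sq_add_cos_sq]
    rw [h1]
    simp [neg_div]

/-- Inverse functions of solutions of `u' ^ 2 + u ^ 2 = 1`. -/
theorem exists_isForbidden_of_inverse_trig {u u' : ℂ → ℂ} (hu : ∀ y, HasDerivAt u (u' y) y)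
    (hu' : Differentiable ℂ u') (hsq : ∀ y, u' y ^ 2 + u y ^ 2 = 1) {a : Sphere}
    {φ : Sphere → ℂ} (hφ : RegularAt φ a)
    (h : ∀ᶠ x in 𝓝 a, ∀ z : ℂ, x = (z : Sphere) → u (φ x) = z) :
    ∃ A : Set Sphere, A.Countable ∧ IsForbidden A a φ := by
  have hcont : Continuous u := continuous_iff_continuousAt.2 fun y => (hu y).continuousAt
  -- At a finite base point the derivative of `φ` in the finite coordinate is again a regular germ.
  obtain ⟨z₀, rfl⟩ := OnePoint.ne_infty_iff_exists.1 (ne_infty_of_inverse hcont hφ h)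
  have hfin := eventually_ne_infty (OnePoint.coe_ne_infty z₀)
  have hd := eventually_hasDerivAt_inverse hφ h
  have hC : RegularAt (fun x => u' (φ x)) (z₀ : Sphere) :=
    RegularAt.comp_analyticAt (hu'.analyticAt _) hφ
  have hpoly : Differentiable ℂ fun z : ℂ => z ^ 2 - 1 := by fun_prop
  -- the derivative of `u` along `φ` is a square root of `1 - z ^ 2`
  let ζ : Fin 2 → Sphere → ℂ := ![fun _ => 0, fun x => finiteCoord x ^ 2 - 1]
  have hζ1 : RegularAt (ζ 1) (z₀ : Sphere) := regularAt_coe.2 (hpoly.analyticAt z₀)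
  obtain ⟨A₁, hA₁, hforb₁⟩ := exists_isForbidden_of_algebraic
    (A := (fun z : ℂ => (z : Sphere)) '' ∅ ∪ {OnePoint.infty})
    ((countable_empty.image _).union (countable_singleton _)) (n := 2) (φ := ζ) (by
      intro i
      fin_cases i
      · exact regularAt_const 0 _
      · exact hζ1) (by
      intro i
      fin_cases i
      · exact (isForbidden_const 0 _).mono (empty_subset _)
      · exact isForbidden_of_function (u := fun z => z ^ 2 - 1) (fun z _ => hpoly.analyticAt z) hζ1
          (Eventually.of_forall fun x z hz => by rw [hz]; rfl)) hC (by
    filter_upwards [hd, hfin] with x hx hx'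
    obtain ⟨z, rfl⟩ := hx'
    have h1 := (hx z rfl).1
    have h2 := hsq (φ z)
    rw [h1] at h2
    simp only [ζ, Fin.sum_univ_two, Matrix.cons_val_zero, Matrix.cons_val_one, finiteCoord_coe,
      zero_mul, zero_add, Fin.val_one, Nat.sub_self, pow_zero, mul_one, Nat.add_one_sub_one]
    linear_combination h2)
  -- the derivative of `φ` is its inverse
  have hD : RegularAt (fun x => deriv (fun w : ℂ => φ w) (finiteCoord x)) (z₀ : Sphere) :=
    regularAt_coe.2 (regularAt_coe.1 hφ).deriv
  have hDC : ∀ᶠ x in 𝓝 (z₀ : Sphere),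
      deriv (fun w : ℂ => φ w) (finiteCoord x) * u' (φ x) = 1 := by
    filter_upwards [hd, hfin] with x hx hx'
    obtain ⟨z, rfl⟩ := hx'
    rw [mul_comm]
    exact ((hx z rfl).2 _ (hu _)).1
  have hforb₂ := ((isForbidden_const 1 (z₀ : Sphere)).mono (empty_subset A₁)).div hforb₁ hD hDC
  have hC0 : ¬ (fun x => u' (φ x)) =ᶠ[𝓝 (z₀ : Sphere)] fun _ => 0 := by
    intro h0
    obtain ⟨x, h1, h2⟩ := (hDC.and h0).exists
    simp only at h2
    rw [h2, mul_zero] at h1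
    exact zero_ne_one h1
  -- `φ` is recovered by integrating `1 / u' (φ x)`. This derivative is multivalued, so
  -- `isForbidden_of_derivative` does not apply and the closure properties are used instead.
  refine ⟨_, (hA₁.union (countable_setOf_reaches_eq hC0)).union (countable_singleton _),
    hforb₂.integral hφ ?_⟩
  filter_upwards [hφ.eventually] with x hx
  rintro z rfl
  exact (regularAt_coe.1 hx).differentiableAt.hasDerivAt

/-- An entire outer function never obstructs continuation; this yields powers from the logarithm. -/
theorem IsForbidden.comp_entire {A : Set Sphere} {a : Sphere} {φ : Sphere → ℂ}
    (hφ : IsForbidden A a φ) {u : ℂ → ℂ} (hu : Differentiable ℂ u) :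
    IsForbidden A a fun x => u (φ x) := by
  intro γ hγ t₀ t₁ ht ha hA
  obtain ⟨F, hF0, hF⟩ := hφ γ hγ t₀ t₁ ht ha hA
  refine ⟨fun t x => u (F t x), hF0.fun_comp u, fun t ht => ⟨?_, ?_⟩⟩
  · exact RegularAt.comp_analyticAt (hu.analyticAt _) (hF t ht).1
  · filter_upwards [(hF t ht).2] with s hs using hs.fun_comp u

/-! ### Functions with a countable forbidden set -/

/-- All germs of `f` share a countable forbidden set. -/
def HasCountableForbiddenSet (f : MultivaluedFunction) : Prop :=
  ∃ A : Set Sphere, A.Countable ∧ ∀ b ψ, f.IsGerm b ψ → IsForbidden A b ψ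

theorem MultivaluedFunction.IsGerm.regularAt {f : MultivaluedFunction} {b : Sphere}
    {ψ : Sphere → ℂ} (h : f.IsGerm b ψ) : RegularAt ψ b := by
  obtain ⟨a, φ, -, hgen⟩ := f.generated
  exact ((hgen b ψ).1 h).reaches.regularAt

/-- One germ is enough, since a countable forbidden set passes to all continuations. -/
theorem MultivaluedFunction.IsGeneratedBy.hasCountableForbiddenSet {f : MultivaluedFunction}
    {a : Sphere} {φ : Sphere → ℂ} (hf : f.IsGeneratedBy a φ)
    (h : ∃ A : Set Sphere, A.Countable ∧ IsForbidden A a φ) : HasCountableForbiddenSet f := by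
  obtain ⟨A, hA, hφ⟩ := h
  exact ⟨A, hA, fun b ψ hb => hφ.of_reaches hA ((hf.2 b ψ).1 hb).reaches⟩

theorem HasCountableForbiddenSet.countable_singularPoints {f : MultivaluedFunction}
    (hf : HasCountableForbiddenSet f) : f.singularPoints.Countable := by
  obtain ⟨A, hA, h⟩ := hf
  refine hA.mono ?_
  rintro b ⟨a, φ, hφ, hs⟩
  exact (h a φ hφ).mem_of_isSingularPoint hA hs

theorem IsFunction.hasCountableForbiddenSet {u : ℂ → ℂ} {f : MultivaluedFunction}
    (hf : IsFunction u f) {B : Set ℂ} (hB : B.Countable) (hu : ∀ z ∉ B, AnalyticAt ℂ u z) :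
    HasCountableForbiddenSet f := by
  obtain ⟨a, φ, hgen, h⟩ := hf
  exact hgen.hasCountableForbiddenSet ⟨_, (hB.image _).union (countable_singleton _),
    isForbidden_of_function hu hgen.1 h⟩

theorem IsFunction.hasCountableForbiddenSet_of_differentiable {u : ℂ → ℂ} {f : MultivaluedFunction}
    (hf : IsFunction u f) (hu : Differentiable ℂ u) : HasCountableForbiddenSet f :=
  hf.hasCountableForbiddenSet countable_empty fun z _ => hu.analyticAt z

theorem countable_setOf_cos_eq_zero : {z : ℂ | Complex.cos z = 0}.Countable := by
  refine (countable_range fun k : ℤ => (2 * k + 1) * (Real.pi : ℂ) / 2).mono fun z hz => ?_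
  obtain ⟨k, hk⟩ := Complex.cos_eq_zero_iff.1 hz
  exact ⟨k, hk.symm⟩

theorem countable_setOf_sin_eq_zero : {z : ℂ | Complex.sin z = 0}.Countable := by
  refine (countable_range fun k : ℤ => (k : ℂ) * Real.pi).mono fun z hz => ?_
  obtain ⟨k, hk⟩ := Complex.sin_eq_zero_iff.1 hz
  exact ⟨k, hk.symm⟩

theorem BasicElementary.hasCountableForbiddenSet {f : MultivaluedFunction}
    (hf : BasicElementary f) : HasCountableForbiddenSet f := by
  cases hf with
  | const c h => exact h.hasCountableForbiddenSet_of_differentiable (differentiable_const c)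
  | var h => exact h.hasCountableForbiddenSet_of_differentiable differentiable_id
  | exp h => exact h.hasCountableForbiddenSet_of_differentiable Complex.differentiable_exp
  | sin h => exact h.hasCountableForbiddenSet_of_differentiable Complex.differentiable_sin
  | cos h => exact h.hasCountableForbiddenSet_of_differentiable Complex.differentiable_cos
  | tan h =>
    exact h.hasCountableForbiddenSet countable_setOf_cos_eq_zero fun z hz =>
      (Complex.differentiable_sin.analyticAt z).fun_div (Complex.differentiable_cos.analyticAt z) hz
  | cot h =>
    exact h.hasCountableForbiddenSet countable_setOf_sin_eq_zero fun z hz =>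
      (Complex.differentiable_cos.analyticAt z).fun_div (Complex.differentiable_sin.analyticAt z) hz
  | log h =>
    obtain ⟨a, φ, hgen, h⟩ := h
    exact hgen.hasCountableForbiddenSet (exists_isForbidden_log hgen.1 h)
  | arctan h =>
    obtain ⟨a, φ, hgen, h⟩ := h
    exact hgen.hasCountableForbiddenSet (exists_isForbidden_arctan hgen.1 h)
  | arccot h =>
    obtain ⟨a, φ, hgen, h⟩ := h
    exact hgen.hasCountableForbiddenSet (exists_isForbidden_arccot hgen.1 h)
  | arcsin h =>
    obtain ⟨a, φ, hgen, h⟩ := h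
    exact hgen.hasCountableForbiddenSet (exists_isForbidden_of_inverse_trig Complex.hasDerivAt_sin
      Complex.differentiable_cos Complex.cos_sq_add_sin_sq hgen.1 h)
  | arccos h =>
    obtain ⟨a, φ, hgen, h⟩ := h
    exact hgen.hasCountableForbiddenSet (exists_isForbidden_of_inverse_trig Complex.hasDerivAt_cos
      Complex.differentiable_sin.neg
      (fun y => by simp) hgen.1 h)
  | power α h =>
    obtain ⟨a, l, hl, h, hgen⟩ := h
    obtain ⟨A, hA, hforb⟩ := exists_isForbidden_log hl h
    exact hgen.hasCountableForbiddenSet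
      ⟨A, hA, hforb.comp_entire (u := fun z => Complex.exp (α * z)) (by fun_prop)⟩

/-! ### Closure under the operations -/

theorem Composition.hasCountableForbiddenSet {fs : List MultivaluedFunction}
    {h : MultivaluedFunction} (hop : Composition fs h)
    (hfs : ∀ f ∈ fs, HasCountableForbiddenSet f) : HasCountableForbiddenSet h := by
  cases hop with
  | @comp f g _ a φ ψ hg hf hgen =>
    obtain ⟨B, hB, hfB⟩ := hfs f (by simp)
    obtain ⟨A, hA, hgA⟩ := hfs g (by simp)
    -- A constant inner germ with value in `B` would make every point forbidden, but then the
    -- composite is constant. Otherwise each of the countably many finite points of `B` is attained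
    -- only countably often.
    by_cases hconst : ψ =ᶠ[𝓝 a] fun _ => ψ a
    · refine hgen.hasCountableForbiddenSet ⟨∅, countable_empty,
        (isForbidden_const (φ ((ψ a : ℂ) : Sphere)) a).congr ?_⟩
      filter_upwards [hconst] with x hx
      rw [hx]
    · refine hgen.hasCountableForbiddenSet ⟨_, hA.union ?_, (hfB _ _ hf).comp (hgA _ _ hg)⟩
      have hk : ∀ k : ℂ, {b | ∃ Ψ, Reaches a ψ b Ψ ∧ Ψ b = k}.Countable := fun k =>
        countable_setOf_reaches_eq fun hk => hconst (by rwa [hk.eq_of_nhds])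
      refine ((hB.preimage_of_injOn (f := fun z : ℂ => (z : Sphere))
        OnePoint.coe_injective.injOn).biUnion fun k _ => hk k).mono ?_
      rintro b ⟨Ψ, hΨ, hb⟩
      exact mem_iUnion₂.2 ⟨Ψ b, hb, Ψ, hΨ, rfl⟩

theorem Arithmetic.hasCountableForbiddenSet {fs : List MultivaluedFunction}
    {h : MultivaluedFunction} (hop : Arithmetic fs h)
    (hfs : ∀ f ∈ fs, HasCountableForbiddenSet f) : HasCountableForbiddenSet h := by
  have key : ∀ {f g : MultivaluedFunction} {a φ ψ}, HasCountableForbiddenSet f →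
      HasCountableForbiddenSet g → f.IsGerm a φ → g.IsGerm a ψ →
      ∃ A : Set Sphere, A.Countable ∧ IsForbidden A a φ ∧ IsForbidden A a ψ := by
    rintro f g a φ ψ ⟨A, hA, hfA⟩ ⟨B, hB, hgB⟩ hφ hψ
    exact ⟨A ∪ B, hA.union hB, (hfA a φ hφ).mono subset_union_left,
      (hgB a ψ hψ).mono subset_union_right⟩
  cases hop with
  | @add f g _ a φ ψ hf hg hgen =>
    obtain ⟨A, hA, h1, h2⟩ := key (hfs f (by simp)) (hfs g (by simp)) hf hg
    exact hgen.hasCountableForbiddenSet ⟨A, hA, h1.add h2⟩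
  | @sub f g _ a φ ψ hf hg hgen =>
    obtain ⟨A, hA, h1, h2⟩ := key (hfs f (by simp)) (hfs g (by simp)) hf hg
    exact hgen.hasCountableForbiddenSet ⟨A, hA, h1.sub h2⟩
  | @mul f g _ a φ ψ hf hg hgen =>
    obtain ⟨A, hA, h1, h2⟩ := key (hfs f (by simp)) (hfs g (by simp)) hf hg
    exact hgen.hasCountableForbiddenSet ⟨A, hA, h1.mul h2⟩
  | @div f g _ a φ ψ χ hf hg h0 hgen heq =>
    obtain ⟨A, hA, h1, h2⟩ := key (hfs f (by simp)) (hfs g (by simp)) hf hg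
    exact hgen.hasCountableForbiddenSet
      ⟨_, hA.union (countable_setOf_reaches_eq h0), h1.div h2 hgen.1 heq⟩

theorem Differentiation.hasCountableForbiddenSet {fs : List MultivaluedFunction}
    {h : MultivaluedFunction} (hop : Differentiation fs h)
    (hfs : ∀ f ∈ fs, HasCountableForbiddenSet f) : HasCountableForbiddenSet h := by
  cases hop with
  | @deriv f _ a φ χ hf hgen hd =>
    obtain ⟨A, hA, hfA⟩ := hfs f (by simp)
    exact hgen.hasCountableForbiddenSet
      ⟨_, hA.union (countable_singleton _), (hfA _ _ hf).deriv hgen.1 hd⟩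

theorem Integration.hasCountableForbiddenSet {fs : List MultivaluedFunction}
    {h : MultivaluedFunction} (hop : Integration fs h)
    (hfs : ∀ f ∈ fs, HasCountableForbiddenSet f) : HasCountableForbiddenSet h := by
  cases hop with
  | @integral f _ a φ χ hf hgen hd =>
    obtain ⟨A, hA, hfA⟩ := hfs f (by simp)
    exact hgen.hasCountableForbiddenSet
      ⟨_, hA.union (countable_singleton _), (hfA _ _ hf).integral hgen.1 hd⟩

theorem Algebraic.hasCountableForbiddenSet {D : ℕ → Prop} {fs : List MultivaluedFunction}
    {h : MultivaluedFunction} (hop : Algebraic D fs h)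
    (hfs : ∀ f ∈ fs, HasCountableForbiddenSet f) : HasCountableForbiddenSet h := by
  cases hop with
  | @solution n f _ a φ χ _ hf hgen heq =>
    choose A hA hfA using fun i => hfs (f i) (by simp)
    exact hgen.hasCountableForbiddenSet (exists_isForbidden_of_algebraic (countable_iUnion hA)
      (fun i => (hf i).regularAt)
      (fun i => (hfA i _ _ (hf i)).mono (subset_iUnion A i)) hgen.1 heq)

theorem FunctionClass.hasCountableForbiddenSet {Op : Operation}
    (hOp : ∀ fs h, Op fs h → (∀ f ∈ fs, HasCountableForbiddenSet f) → HasCountableForbiddenSet h)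
    {f : MultivaluedFunction} (hf : FunctionClass BasicElementary Op f) :
    HasCountableForbiddenSet f := by
  induction hf with
  | basic h => exact h.hasCountableForbiddenSet
  | op _ hop ih => exact hOp _ _ hop ih

theorem FunctionClass.mono {Basic : MultivaluedFunction → Prop} {Op Op' : Operation} (h : Op ≤ Op')
    {f : MultivaluedFunction} (hf : FunctionClass Basic Op f) : FunctionClass Basic Op' f := by
  induction hf with
  | basic hb => exact .basic hb
  | op _ hop ih => exact .op ih (h _ _ hop)

theorem RepresentableByGeneralizedQuadratures.hasCountableForbiddenSet {f : MultivaluedFunction}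
    (hf : RepresentableByGeneralizedQuadratures f) : HasCountableForbiddenSet f := by
  refine FunctionClass.hasCountableForbiddenSet ?_ hf
  rintro fs h ((((hop | hop) | hop) | hop) | hop) hfs
  · exact hop.hasCountableForbiddenSet hfs
  · exact hop.hasCountableForbiddenSet hfs
  · exact hop.hasCountableForbiddenSet hfs
  · exact hop.hasCountableForbiddenSet hfs
  · exact hop.hasCountableForbiddenSet hfs

theorem Algebraic.le_of_imp {D D' : ℕ → Prop} (h : ∀ n, D n → D' n) :
    Algebraic D ≤ Algebraic D' := by
  rintro fs g ⟨hD, hf, hgen, heq⟩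
  exact .solution (h _ hD) hf hgen heq

end FiniteTerms

theorem corollary5 (f : FiniteTerms.MultivaluedFunction) (hf : ¬ f.singularPoints.Countable) :
    ¬ FiniteTerms.RepresentableByGeneralizedQuadratures f ∧
    ¬ FiniteTerms.GeneralizedElementary f ∧
    (∀ k : ℕ, ¬ FiniteTerms.RepresentableByKQuadratures k f) ∧
    ¬ FiniteTerms.RepresentableByQuadratures f := by
  have key : ¬ FiniteTerms.RepresentableByGeneralizedQuadratures f := fun h =>
    hf h.hasCountableForbiddenSet.countable_singularPoints
  refine ⟨key, fun h => key (h.mono ?_), fun k h => key (h.mono ?_), fun h => key (h.mono ?_)⟩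
  · exact sup_le_sup_right le_sup_left _
  · exact sup_le_sup_left (FiniteTerms.Algebraic.le_of_imp fun _ _ => trivial) _
  · exact le_sup_left
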